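/- Let $E$ be a finite set, $\Omega=E^{\mathbb Z^d}$ with the product topology and product $\sigma$-field $\mathcal F$; for $\Delta\subset\mathbb Z^d$ let $\mathcal F_\Delta$ be the $\sigma$-field generated by the coordinates in $\Delta$, and for $x\in\mathbb Z^d$ let $(\tau_x\omega)(y)=\omega(x+y)$. A *specification* is a family $\gamma=(\gamma_\Lambda)$, indexed by the finite $\Lambda\subset\mathbb Z^d$, of probability kernels from $(\Omega,\mathcal F_{\Lambda^c})$ to $(\Omega,\mathcal F)$ that is proper ($\gamma_\Lambda(B\mid\omega)=\mathbf 1_B(\omega)$ for $B\in\mathcal F_{\Lambda^c}$) and consistent ($\gamma_{\Lambda'}\gamma_\Lambda=\gamma_{\Lambda'}$ for $\Lambda\subset\Lambda'$). It is *translation-invariant* if $\gamma_{\Lambda+x}(A\mid\omega)=\gamma_\Lambda(\tau_xA\mid\tau_x\omega)$ for all $x,\Lambda,\omega$ and $A\in\mathcal F$; *quasilocal* if $\gamma_\Lambda f$ is continuous for every finite $\Lambda$ and every local $f$ (that is, $f$ is $\mathcal F_\Delta$-measurable for some finite $\Delta$); *nonnull* if for every nonempty finite $\Lambda$ there are $0<a_\Lambda<b_\Lambda<1$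 with $a_\Lambda<\inf_{\sigma,\eta}\gamma_\Lambda(\sigma\mid\eta)\le\sup_{\sigma,\eta}\gamma_\Lambda(\sigma\mid\eta)<b_\Lambda$, where $\gamma_\Lambda(\sigma\mid\eta)$ is the $\gamma_\Lambda(\cdot\mid\eta)$-probability of agreeing with $\sigma$ on $\Lambda$. Let $\mathcal G_{\rm inv}(\gamma)$ be the set of translation-invariant probability measures $\mu$ on $\Omega$ with $\mu[A\mid\mathcal F_{\Lambda^c}]=\gamma_\Lambda(A\mid\cdot)$ $\mu$-a.e. for all $A\in\mathcal F$ and all finite $\Lambda$. For probability measures $\mu,\nu$ on $\Omega$ let $\mu_\Lambda,\nu_\Lambda$ be the laws of $\omega_\Lambda$, and let $h_\Lambda(\mu\mid\nu)=\int\frac{d\mu_\Lambda}{d\nu_\Lambda}\log\frac{d\mu_\Lambda}{d\nu_\Lambda}\,d\nu_\Lambda$ if $\mu_\Lambda\ll\nu_\Lambda$, and $+\infty$ otherwise. **Theorem 4.1.** Let $\gamma$ be a translation-invariant, nonnull, quasilocal specification and let $\nu\in\mathcal G_{\rm inv}(\gamma)$. Then for every translation-invariant probability measure $\mu$ on $\Omega$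 the limit $$h(\mu\mid\nu)=\lim_{n\to\infty}\frac{1}{|\Lambda_n|}h_{\Lambda_n}(\mu\mid\nu)$$ along the cubes $\Lambda_n=[-n,n]^d\cap\mathbb Z^d$ exists in $[0,\infty)$, and the limit exists with the same value along every van Hove sequence (nonempty finite $\Lambda_n\subset\mathbb Z^d$ with $|(\Lambda_n+x)\setminus\Lambda_n|/|\Lambda_n|\to0$ for each $x\in\mathbb Z^d$). Moreover $$\mu\in\mathcal G_{\rm inv}(\gamma)\iff h(\mu\mid\nu)=0 .$$ -/

import Mathlib

open MeasureTheory ProbabilityTheory Filter Topology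
open scoped ENNReal NNReal

namespace LatticeGibbs

/-- The lattice `ℤ^d`. -/
abbrev Site (d : ℕ) : Type := Fin d → ℤ

/-- The configuration space `Ω = E^{ℤ^d}`, with the product topology and product σ-algebra. -/
abbrev Config (d : ℕ) (E : Type*) : Type _ := Site d → E

/-- The translate `Λ + x` of a finite volume. -/
def translate {d : ℕ} (Λ : Finset (Site d)) (x : Site d) : Finset (Site d) :=
  Λ.map (addRightEmbedding x)

/-- The translation `(τ_x ω)(y) = ω(x + y)` on configurations. -/
def shift {d : ℕ} {E : Type*} (x : Site d) (ω : Config d E) : Config d E :=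
  fun y => ω (x + y)

/-- The cylinder set of all configurations that agree with `σ` on `Λ`. -/
def cylinderAt {d : ℕ} {E : Type*} (Λ : Finset (Site d)) (σ : Config d E) : Set (Config d E) :=
  {ω | ∀ x ∈ Λ, ω x = σ x}

/-- The cubes `[-n, n]^d ∩ ℤ^d`. -/
noncomputable def cube (d n : ℕ) : Finset (Site d) :=
  Finset.Icc (fun _ => -(n : ℤ)) (fun _ => (n : ℤ))

/-- Van Hove sequences: nonempty finite volumes such that, for every fixed vector `x`, the number
of sites of `Λ_n + x` outside `Λ_n` is negligible with respect to `|Λ_n|`. -/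
def IsVanHove {d : ℕ} (Λ : ℕ → Finset (Site d)) : Prop :=
  (∀ n, (Λ n).Nonempty) ∧
    ∀ x : Site d,
      Tendsto (fun n => ((translate (Λ n) x \ Λ n).card : ℝ) / ((Λ n).card : ℝ)) atTop (𝓝 0)

/-- A specification: a family of probability kernels `γ_Λ` from `(Ω, 𝓕_{Λᶜ})` to `(Ω, 𝓕)`,
indexed by the finite volumes `Λ`, which are proper and consistent.
Here `𝓕_Δ` (for `Δ ⊆ ℤ^d`) is the σ-algebra `cylinderEvents Δ` generated by the coordinates
in `Δ`, and `ker Λ ω A` is `γ_Λ(A | ω)`. -/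
structure Specification (d : ℕ) (E : Type*) [MeasurableSpace E] where
  /-- the kernels `γ_Λ` -/
  ker : (Λ : Finset (Site d)) →
    Kernel[cylinderEvents (X := fun _ : Site d => E) ((Λ : Set (Site d))ᶜ), MeasurableSpace.pi]
      (Config d E) (Config d E)
  isProbability : ∀ Λ ω, IsProbabilityMeasure (ker Λ ω)
  proper : ∀ Λ, (ker Λ).IsProper
  consistent : ∀ Λ Λ' : Finset (Site d), Λ ⊆ Λ' → ∀ (ω : Config d E) (A : Set (Config d E)),
    MeasurableSet A → ∫⁻ ω', ker Λ ω' A ∂(ker Λ' ω) = ker Λ' ω A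

section

variable {d : ℕ} {E : Type*} [MeasurableSpace E]

/-- `γ_{Λ+x}(A | ω) = γ_Λ(τ_x A | τ_x ω)`. -/
def Specification.IsTranslationInvariant (γ : Specification d E) : Prop :=
  ∀ (x : Site d) (Λ : Finset (Site d)) (ω : Config d E) (A : Set (Config d E)), MeasurableSet A →
    γ.ker (translate Λ x) ω A = γ.ker Λ (shift x ω) (shift x '' A)

/-- Nonnullness: for every nonempty finite `Λ` there are `0 < a < b < 1` with
`a < inf_{σ,η} γ_Λ(σ | η) ≤ sup_{σ,η} γ_Λ(σ | η) < b`. (For `Λ = ∅` one always has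
`γ_Λ(σ | η) = 1`.) -/
def Specification.IsNonnull (γ : Specification d E) : Prop :=
  ∀ Λ : Finset (Site d), Λ.Nonempty → ∃ a b : ℝ≥0∞, 0 < a ∧ a < b ∧ b < 1 ∧
    a < (⨅ (σ : Config d E) (η : Config d E), γ.ker Λ η (cylinderAt Λ σ)) ∧
    (⨆ (σ : Config d E) (η : Config d E), γ.ker Λ η (cylinderAt Λ σ)) < b

/-- A local function: a real function measurable with respect to finitely many coordinates. -/
def IsLocal (f : Config d E → ℝ) : Prop :=
  ∃ Δ : Finset (Site d),
    Measurable[cylinderEvents (X := fun _ : Site d => E) (Δ : Set (Site d))] f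

/-- Quasilocality: `γ_Λ f` is continuous for every finite `Λ` and every local `f`. -/
def Specification.IsQuasilocal [TopologicalSpace E] (γ : Specification d E) : Prop :=
  ∀ (Λ : Finset (Site d)) (f : Config d E → ℝ), IsLocal f →
    Continuous fun ω => ∫ σ, f σ ∂(γ.ker Λ ω)

/-- The translation-invariant probability measures on `Ω`. -/
def invMeasures (d : ℕ) (E : Type*) [MeasurableSpace E] : Set (ProbabilityMeasure (Config d E)) :=
  {μ | ∀ x : Site d, (μ : Measure (Config d E)).map (shift x) = μ}

/-- `𝓖(γ)`: the probability measures `μ` with `μ[A | 𝓕_{Λᶜ}] = γ_Λ(A | ·)` `μ`-almost everywhere,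
for all measurable `A` and all finite `Λ`. -/
def Specification.gibbs (γ : Specification d E) : Set (ProbabilityMeasure (Config d E)) :=
  {μ | ∀ (Λ : Finset (Site d)) (A : Set (Config d E)), MeasurableSet A →
    ((μ : Measure (Config d E))⟦A |
        cylinderEvents (X := fun _ : Site d => E) ((Λ : Set (Site d))ᶜ)⟧)
      =ᵐ[(μ : Measure (Config d E))] fun ω => (γ.ker Λ ω A).toReal}

/-- `𝓖_inv(γ)`: the translation-invariant elements of `𝓖(γ)`. -/
def Specification.gibbsInv (γ : Specification d E) : Set (ProbabilityMeasure (Config d E)) :=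
  γ.gibbs ∩ invMeasures d E

/-- The finite-volume relative entropy `h_Λ(μ | ν)`: the relative entropy (Kullback-Leibler
divergence) of the distributions of `ω_Λ` under `μ` and `ν`. -/
noncomputable def finiteVolumeRelEntropy (Λ : Finset (Site d))
    (μ ν : ProbabilityMeasure (Config d E)) : ℝ≥0∞ :=
  InformationTheory.klDiv ((μ : Measure (Config d E)).map Λ.restrict)
    ((ν : Measure (Config d E)).map Λ.restrict)

/-- `h` is the limit of `h_{Λ_n}(μ | ν) / |Λ_n|` along the sequence of volumes `Λ_n`. -/
def IsRelEntropyDensityAlong (Λ : ℕ → Finset (Site d)) (μ ν : ProbabilityMeasure (Config d E))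
    (h : ℝ≥0∞) : Prop :=
  Tendsto (fun n => finiteVolumeRelEntropy (Λ n) μ ν / ((Λ n).card : ℝ≥0∞)) atTop (𝓝 h)

end

end LatticeGibbs

set_option linter.unusedSectionVars false

/-! ### Cylinder probabilities, finite-volume relative entropy, conditional entropy -/

namespace LatticeGibbs

variable {d : ℕ} {E : Type*}

/-! The core is the formula h(μ|ν) = P(ν) − P(μ), where P(ρ) is `entropyDensity ρ` plus the ρ-mean
of `flipEnergy`; P depends on γ and a fixed spin e, but not on ν. Since h_Λ(μ|ν) = −S_Λ(μ) − ∫ log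
ν_Λ dμ, two limits per site are needed.

The entropy S_Λ is expanded by the chain rule in lexicographic order. Conditional entropy decreases
as the conditioning grows, so every site deep inside Λ contributes nearly the infimum over finite
parts of its past (`tendsto_entropy_div_card`).

The energy limit uses no potential. The spins are replaced by e one at a time in lexicographic
order. Under ν, the probability of a spin given the rest of Λ is an average of γ over the spins
outside Λ, and by quasilocality and compactness γ hardly depends on them deep inside Λ
(`prob_update_pos_and_abs_log_le`). Each replacement thus changes log ν_Λ by nearly a translate of
`flipEnergy` (`tendsto_integral_log_prob_sub_div_card`). The leftover log ν(e_Λ) cancels on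
subtracting the same expansion of h_Λ(ν|ν) = 0.

If μ is Gibbs too, μ and ν can be exchanged, and nonnegativity of both densities forces P(μ) = P(ν).
Conversely, if the density vanishes, a large cube is cut into disjoint blocks, one of which must add
little relative entropy (`exists_relEnt_sub_relEnt_sdiff_le`). Translated to the origin, this gives
Λ ⊇ Δ with h_Λ(μ|ν) − h_{Λ∖Δ}(μ|ν) tiny. Up to a small error this difference bounds h_Λ(μ|μγ_Δ)
(`relEnt_update_le`), so μ and μγ_Δ have the same finite marginals. -/

lemma mem_cylinderAt {Λ : Finset (Site d)} {σ ω : Config d E} :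
    ω ∈ cylinderAt Λ σ ↔ ∀ x ∈ Λ, ω x = σ x := Iff.rfl

lemma self_mem_cylinderAt (Λ : Finset (Site d)) (σ : Config d E) : σ ∈ cylinderAt Λ σ :=
  fun _ _ => rfl

lemma cylinderAt_congr {Λ : Finset (Site d)} {σ ω : Config d E} (h : ∀ x ∈ Λ, ω x = σ x) :
    cylinderAt Λ ω = cylinderAt Λ σ := by
  ext η
  exact forall₂_congr fun x hx => by rw [h x hx]

lemma cylinderAt_anti {Δ Λ : Finset (Site d)} (h : Δ ⊆ Λ) (σ : Config d E) :
    cylinderAt Λ σ ⊆ cylinderAt Δ σ := fun _ hη x hx => hη x (h hx)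

lemma cylinderAt_union (Δ Λ : Finset (Site d)) (σ : Config d E) :
    cylinderAt (Δ ∪ Λ) σ = cylinderAt Δ σ ∩ cylinderAt Λ σ := by
  ext η
  simp only [mem_cylinderAt, Finset.mem_union, Set.mem_inter_iff, or_imp, forall_and]

lemma cylinderAt_eq_preimage (Λ : Finset (Site d)) (σ : Config d E) :
    cylinderAt Λ σ = (Λ.restrict : Config d E → (Λ → E)) ⁻¹' {(Λ.restrict σ : Λ → E)} := by
  ext η
  simp [mem_cylinderAt, funext_iff]

lemma cylinderAt_eq_biInter (Λ : Finset (Site d)) (σ : Config d E) :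
    cylinderAt Λ σ = ⋂ x ∈ Λ, (fun ω : Config d E => ω x) ⁻¹' {σ x} := by
  ext η
  simp [mem_cylinderAt]

section

variable [MeasurableSpace E] [DiscreteMeasurableSpace E]

lemma measurableSet_cylinderEvents_cylinderAt {Λ : Finset (Site d)} {s : Set (Site d)}
    (h : (Λ : Set (Site d)) ⊆ s) (σ : Config d E) :
    MeasurableSet[cylinderEvents (X := fun _ : Site d => E) s] (cylinderAt Λ σ) := by
  rw [cylinderAt_eq_biInter]
  refine Finset.measurableSet_biInter _ fun x hx => ?_
  exact measurable_cylinderEvent_apply (X := fun _ : Site d => E) (h hx) (MeasurableSet.of_discrete)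

lemma measurableSet_cylinderAt (Λ : Finset (Site d)) (σ : Config d E) :
    MeasurableSet (cylinderAt Λ σ) :=
  cylinderEvents_le_pi _ (measurableSet_cylinderEvents_cylinderAt subset_rfl σ)

/-- The probability under `μ` of the cylinder set of configurations agreeing with `ω` on `Λ`. -/
noncomputable def prob (μ : Measure (Config d E)) (Λ : Finset (Site d)) (ω : Config d E) : ℝ :=
  μ.real (cylinderAt Λ ω)

lemma prob_congr (μ : Measure (Config d E)) {Λ : Finset (Site d)} {σ ω : Config d E}
    (h : ∀ x ∈ Λ, ω x = σ x) : prob μ Λ ω = prob μ Λ σ := by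
  rw [prob, prob, cylinderAt_congr h]

lemma prob_nonneg (μ : Measure (Config d E)) (Λ : Finset (Site d)) (ω : Config d E) :
    0 ≤ prob μ Λ ω := measureReal_nonneg

lemma prob_anti (μ : Measure (Config d E)) [IsFiniteMeasure μ] {Δ Λ : Finset (Site d)}
    (h : Δ ⊆ Λ) (ω : Config d E) : prob μ Λ ω ≤ prob μ Δ ω :=
  measureReal_mono (cylinderAt_anti h ω)

lemma prob_empty (μ : Measure (Config d E)) [IsProbabilityMeasure μ] (ω : Config d E) :
    prob μ ∅ ω = 1 := by
  have : cylinderAt ∅ ω = Set.univ := by ext; simp [mem_cylinderAt]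
  simp [prob, this]

lemma map_restrict_real_singleton (μ : Measure (Config d E)) (Λ : Finset (Site d))
    (ω : Config d E) : (μ.map Λ.restrict).real {Λ.restrict ω} = prob μ Λ ω := by
  rw [prob, cylinderAt_eq_preimage, map_measureReal_apply (Finset.measurable_restrict Λ)
    (MeasurableSet.singleton _)]

variable [Finite E]

lemma dependsOn_exists {α : Type*} [Nonempty α] {f : Config d E → α} {Λ : Finset (Site d)}
    (hf : DependsOn f (Λ : Set (Site d))) : ∃ g : (Λ → E) → α, f = g ∘ Λ.restrict := by
  have h := (Function.factorsThrough_iff (f := (Λ.restrict : Config d E → (Λ → E))) f).1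
    (fun ω ω' h => hf fun x hx => congrFun h ⟨x, hx⟩)
  exact h

lemma measurable_of_dependsOn {f : Config d E → ℝ} {Λ : Finset (Site d)}
    (hf : DependsOn f (Λ : Set (Site d))) : Measurable f := by
  obtain ⟨g, rfl⟩ := dependsOn_exists hf
  exact (measurable_of_finite g).comp (Finset.measurable_restrict Λ)

lemma integrable_of_dependsOn (μ : Measure (Config d E)) [IsFiniteMeasure μ]
    {f : Config d E → ℝ} {Λ : Finset (Site d)}
    (hf : DependsOn f (Λ : Set (Site d))) : Integrable f μ := by
  have hm := measurable_of_dependsOn hf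
  obtain ⟨g, rfl⟩ := dependsOn_exists hf
  obtain ⟨C, hC⟩ := (Set.finite_range fun s => ‖g s‖).bddAbove
  exact Integrable.of_bound hm.aestronglyMeasurable C
    (Eventually.of_forall fun ω => hC ⟨Λ.restrict ω, rfl⟩)

lemma dependsOn_log_prob (μ : Measure (Config d E)) (Λ : Finset (Site d)) :
    DependsOn (fun ω => Real.log (prob μ Λ ω)) (Λ : Set (Site d)) :=
  fun ω σ h => by simp only [prob_congr μ h]

lemma integrable_log_prob (μ ν : Measure (Config d E)) [IsFiniteMeasure μ]
    (Λ : Finset (Site d)) : Integrable (fun ω => Real.log (prob ν Λ ω)) μ :=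
  integrable_of_dependsOn μ (dependsOn_log_prob ν Λ)

/-- There are only finitely many patterns on Λ, and the null ones together are null. This keeps the
default value log 0 = 0 out of all integrals against μ. -/
lemma ae_prob_pos (μ : Measure (Config d E)) [IsFiniteMeasure μ] (Λ : Finset (Site d)) :
    ∀ᵐ ω ∂μ, 0 < prob μ Λ ω := by
  have h : ∀ᵐ s ∂(μ.map Λ.restrict), 0 < (μ.map Λ.restrict).real {s} := by
    rw [ae_iff_of_countable]
    intro s hs
    exact ENNReal.toReal_pos hs (measure_ne_top _ _)
  filter_upwards [ae_of_ae_map (Finset.measurable_restrict Λ).aemeasurable h] with ω hω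
  rwa [map_restrict_real_singleton] at hω

/-- The relative entropy in `Λ` as an integral of log-likelihood ratios. -/
noncomputable def relEnt (Λ : Finset (Site d)) (μ ν : Measure (Config d E)) : ℝ :=
  ∫ ω, (Real.log (prob μ Λ ω) - Real.log (prob ν Λ ω)) ∂μ

/-- Absolute continuity of the restriction of `μ` to `Λ` with respect to that of `ν`. -/
def AbsContOn (Λ : Finset (Site d)) (μ ν : Measure (Config d E)) : Prop :=
  ∀ ω, prob ν Λ ω = 0 → prob μ Λ ω = 0

lemma AbsContOn.map_restrict {Λ : Finset (Site d)} {μ ν : Measure (Config d E)}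
    [IsProbabilityMeasure μ] [IsProbabilityMeasure ν] (h : AbsContOn Λ μ ν) :
    μ.map Λ.restrict ≪ ν.map Λ.restrict := by
  have hE : Nonempty (Config d E) := nonempty_of_isProbabilityMeasure μ
  have hμ := Measure.isProbabilityMeasure_map (μ := μ) (Finset.measurable_restrict Λ).aemeasurable
  have hν := Measure.isProbabilityMeasure_map (μ := ν) (Finset.measurable_restrict Λ).aemeasurable
  refine Measure.AbsolutelyContinuous.mk fun s _ hs => ?_
  rw [← s.biUnion_of_singleton, measure_biUnion_null_iff s.to_countable]
  intro a ha
  obtain ⟨ω, rfl⟩ : ∃ ω : Config d E, Λ.restrict ω = a := by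
    classical
    obtain ⟨o⟩ := hE
    refine ⟨fun x => if hx : x ∈ Λ then a ⟨x, hx⟩ else o x, ?_⟩
    ext ⟨x, hx⟩
    simp [hx]
  have h0 : (ν.map Λ.restrict) {Λ.restrict ω} = 0 :=
    measure_mono_null (Set.singleton_subset_iff.2 ha) hs
  have h1 := h ω (by rw [← map_restrict_real_singleton, measureReal_def, h0, ENNReal.toReal_zero])
  rwa [← map_restrict_real_singleton, measureReal_eq_zero_iff] at h1

lemma klDiv_map_restrict_ne_top {Λ : Finset (Site d)} {μ ν : Measure (Config d E)}
    [IsProbabilityMeasure μ] [IsProbabilityMeasure ν] (h : AbsContOn Λ μ ν) :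
    InformationTheory.klDiv (μ.map Λ.restrict) (ν.map Λ.restrict) ≠ ∞ := by
  have hμ := Measure.isProbabilityMeasure_map (μ := μ) (Finset.measurable_restrict Λ).aemeasurable
  exact InformationTheory.klDiv_ne_top h.map_restrict Integrable.of_finite

lemma toReal_klDiv_map_restrict {Λ : Finset (Site d)} {μ ν : Measure (Config d E)}
    [IsProbabilityMeasure μ] [IsProbabilityMeasure ν] (h : AbsContOn Λ μ ν) :
    (InformationTheory.klDiv (μ.map Λ.restrict) (ν.map Λ.restrict)).toReal = relEnt Λ μ ν := by
  have hμ := Measure.isProbabilityMeasure_map (μ := μ) (Finset.measurable_restrict Λ).aemeasurable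
  have hν := Measure.isProbabilityMeasure_map (μ := ν) (Finset.measurable_restrict Λ).aemeasurable
  have hr := Finset.measurable_restrict (X := fun _ : Site d => E) Λ
  rw [InformationTheory.toReal_klDiv_of_measure_eq h.map_restrict (by simp),
    integral_map hr.aemeasurable (measurable_of_finite _).aestronglyMeasurable, relEnt]
  refine integral_congr_ae ?_
  filter_upwards [ae_prob_pos μ Λ] with ω hω
  have hν0 : 0 < prob ν Λ ω :=
    lt_of_le_of_ne (prob_nonneg _ _ _) fun h0 => hω.ne' (h ω h0.symm)
  -- At an atom the Radon-Nikodym derivative is the quotient of the masses.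
  have key : (μ.map Λ.restrict) {Λ.restrict ω} =
      (μ.map Λ.restrict).rnDeriv (ν.map Λ.restrict) (Λ.restrict ω) *
        (ν.map Λ.restrict) {Λ.restrict ω} := by
    conv_lhs => rw [← Measure.withDensity_rnDeriv_eq _ _ h.map_restrict]
    rw [withDensity_apply _ (MeasurableSet.singleton _), lintegral_singleton]
  have key' := congrArg ENNReal.toReal key
  rw [ENNReal.toReal_mul, ← measureReal_def, ← measureReal_def, map_restrict_real_singleton,
    map_restrict_real_singleton] at key'
  rw [llr, ← Real.log_div hω.ne' hν0.ne', key', mul_div_cancel_right₀ _ hν0.ne']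

lemma relEnt_nonneg {Λ : Finset (Site d)} {μ ν : Measure (Config d E)}
    [IsProbabilityMeasure μ] [IsProbabilityMeasure ν] (h : AbsContOn Λ μ ν) :
    0 ≤ relEnt Λ μ ν := by
  rw [← toReal_klDiv_map_restrict h]; exact ENNReal.toReal_nonneg

lemma klDiv_map_restrict {Λ : Finset (Site d)} {μ ν : Measure (Config d E)}
    [IsProbabilityMeasure μ] [IsProbabilityMeasure ν] (h : AbsContOn Λ μ ν) :
    InformationTheory.klDiv (μ.map Λ.restrict) (ν.map Λ.restrict) =
      ENNReal.ofReal (relEnt Λ μ ν) := by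
  rw [← toReal_klDiv_map_restrict h, ENNReal.ofReal_toReal (klDiv_map_restrict_ne_top h)]

/-- Data processing: the marginal on Δ is an image of the marginal on Λ. -/
lemma klDiv_map_restrict_mono {Δ Λ : Finset (Site d)} (hΔ : Δ ⊆ Λ) (μ ν : Measure (Config d E))
    [IsProbabilityMeasure μ] [IsProbabilityMeasure ν] :
    InformationTheory.klDiv (μ.map Δ.restrict) (ν.map Δ.restrict) ≤
      InformationTheory.klDiv (μ.map Λ.restrict) (ν.map Λ.restrict) := by
  have hμ := Measure.isProbabilityMeasure_map (μ := μ) (Finset.measurable_restrict Λ).aemeasurable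
  have hν := Measure.isProbabilityMeasure_map (μ := ν) (Finset.measurable_restrict Λ).aemeasurable
  have hm : Measurable (Finset.restrict₂ (π := fun _ : Site d => E) hΔ) :=
    Finset.measurable_restrict₂ hΔ
  have hc : (Δ.restrict : Config d E → (Δ → E)) =
    Finset.restrict₂ (π := fun _ : Site d => E) hΔ ∘ Λ.restrict := rfl
  rw [hc, ← Measure.map_map hm (Finset.measurable_restrict Λ),
    ← Measure.map_map hm (Finset.measurable_restrict Λ)]
  exact InformationTheory.klDiv_map_le _ _ hm

lemma relEnt_mono {Δ Λ : Finset (Site d)} (hΔ : Δ ⊆ Λ) {μ ν : Measure (Config d E)}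
    [IsProbabilityMeasure μ] [IsProbabilityMeasure ν]
    (h' : AbsContOn Δ μ ν) (h : AbsContOn Λ μ ν) : relEnt Δ μ ν ≤ relEnt Λ μ ν := by
  rw [← toReal_klDiv_map_restrict h, ← toReal_klDiv_map_restrict h']
  exact ENNReal.toReal_mono (klDiv_map_restrict_ne_top h) (klDiv_map_restrict_mono hΔ μ ν)

/-- The Shannon entropy of the restriction of `μ` to `Λ`. -/
noncomputable def entropy (μ : Measure (Config d E)) (Λ : Finset (Site d)) : ℝ :=
  -∫ ω, Real.log (prob μ Λ ω) ∂μ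

lemma entropy_empty (μ : Measure (Config d E)) [IsProbabilityMeasure μ] : entropy μ ∅ = 0 := by
  simp [entropy, prob_empty]

lemma relEnt_eq (Λ : Finset (Site d)) (μ ν : Measure (Config d E)) [IsProbabilityMeasure μ] :
    relEnt Λ μ ν = -entropy μ Λ - ∫ ω, Real.log (prob ν Λ ω) ∂μ := by
  rw [relEnt, integral_sub (integrable_log_prob μ μ Λ) (integrable_log_prob μ ν Λ), entropy,
    neg_neg]

/-- The measure obtained from `μ` by resampling the spin at `x` uniformly. -/
noncomputable def resample (μ : Measure (Config d E)) (x : Site d) : Measure (Config d E) :=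
  (μ.prod (uniformOn (Set.univ : Set E))).map fun p => Function.update p.1 x p.2

lemma measurable_update_prod (x : Site d) :
    Measurable fun p : Config d E × E => Function.update p.1 x p.2 := by
  refine measurable_pi_lambda _ fun y => ?_
  by_cases h : y = x
  · subst h; simpa using measurable_snd
  · simp only [Function.update_of_ne h]
    exact (measurable_pi_apply y).comp measurable_fst

lemma isProbabilityMeasure_uniformOn_univ [Nonempty E] :
    IsProbabilityMeasure (uniformOn (Set.univ : Set E)) :=
  isProbabilityMeasure_uniformOn Set.finite_univ Set.univ_nonempty

lemma isProbabilityMeasure_resample [Nonempty E] (μ : Measure (Config d E))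
    [IsProbabilityMeasure μ] (x : Site d) : IsProbabilityMeasure (resample μ x) := by
  have := isProbabilityMeasure_uniformOn_univ (E := E)
  exact Measure.isProbabilityMeasure_map (measurable_update_prod x).aemeasurable

lemma prob_resample [Nonempty E] (μ : Measure (Config d E)) [IsProbabilityMeasure μ] {x : Site d}
    {A : Finset (Site d)} (hx : x ∉ A) (ω : Config d E) :
    prob (resample μ x) (insert x A) ω = prob μ A ω / Nat.card E := by
  have := isProbabilityMeasure_uniformOn_univ (E := E)
  have hpre : (fun p : Config d E × E => Function.update p.1 x p.2) ⁻¹'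
      cylinderAt (insert x A) ω = cylinderAt A ω ×ˢ {ω x} := by
    ext ⟨η, e⟩
    simp only [Set.mem_preimage, mem_cylinderAt, Finset.mem_insert, forall_eq_or_imp,
      Function.update_self, Set.mem_prod, Set.mem_singleton_iff]
    rw [and_comm]
    refine and_congr_left fun _ => forall₂_congr fun y hy => ?_
    rw [Function.update_of_ne (by rintro rfl; exact hx hy)]
  have hu : (uniformOn (Set.univ : Set E)).real {ω x} = 1 / Nat.card E := by
    have := Fintype.ofFinite E
    classical
    rw [measureReal_def, uniformOn_univ, Measure.count_singleton]
    simp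
  rw [prob, resample, map_measureReal_apply (measurable_update_prod x)
    (measurableSet_cylinderAt _ _), hpre, measureReal_prod_prod, hu, prob, mul_one_div]

lemma absContOn_resample [Nonempty E] (μ : Measure (Config d E)) [IsProbabilityMeasure μ]
    {x : Site d} {A : Finset (Site d)} (hx : x ∉ A) :
    AbsContOn (insert x A) μ (resample μ x) := by
  intro ω h
  rw [prob_resample μ hx, div_eq_zero_iff, Nat.cast_eq_zero] at h
  rcases h with h | h
  · exact le_antisymm (h ▸ prob_anti μ (Finset.subset_insert _ _) ω) (prob_nonneg _ _ _)
  · exact absurd h Nat.card_pos.ne'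

/-- Conditional entropy is a constant minus a relative entropy, so nonnegativity and monotonicity of
relative entropy become the upper bound and the antitonicity of `condEntropy`. -/
lemma relEnt_resample [Nonempty E] (μ : Measure (Config d E)) [IsProbabilityMeasure μ]
    {x : Site d} {A : Finset (Site d)} (hx : x ∉ A) :
    relEnt (insert x A) μ (resample μ x) =
      Real.log (Nat.card E) - (entropy μ (insert x A) - entropy μ A) := by
  have h : ∫ ω, Real.log (prob (resample μ x) (insert x A) ω) ∂μ =
      -entropy μ A - Real.log (Nat.card E) := by
    have : ∫ ω, Real.log (prob (resample μ x) (insert x A) ω) ∂μ =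
        ∫ ω, (Real.log (prob μ A ω) - Real.log (Nat.card E)) ∂μ := by
      refine integral_congr_ae ?_
      filter_upwards [ae_prob_pos μ A] with ω hω
      rw [prob_resample μ hx, Real.log_div hω.ne' (Nat.cast_ne_zero.2 Nat.card_pos.ne')]
    rw [this, integral_sub (integrable_log_prob μ μ A) (integrable_const _), entropy]
    simp
  rw [relEnt_eq, h]
  ring

/-- The conditional entropy of the spin at `x` given the spins in `A`. -/
noncomputable def condEntropy (μ : Measure (Config d E)) (x : Site d) (A : Finset (Site d)) : ℝ :=
  entropy μ (insert x A) - entropy μ A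

lemma condEntropy_nonneg (μ : Measure (Config d E)) [IsProbabilityMeasure μ] (x : Site d)
    (A : Finset (Site d)) : 0 ≤ condEntropy μ x A := by
  rw [condEntropy, entropy, entropy, neg_sub_neg, sub_nonneg]
  refine integral_mono_ae (integrable_log_prob μ μ _) (integrable_log_prob μ μ _) ?_
  filter_upwards [ae_prob_pos μ (insert x A)] with ω hω
  exact Real.log_le_log hω (prob_anti μ (Finset.subset_insert _ _) ω)

lemma condEntropy_le [Nonempty E] (μ : Measure (Config d E)) [IsProbabilityMeasure μ] {x : Site d}
    {A : Finset (Site d)} (hx : x ∉ A) : condEntropy μ x A ≤ Real.log (Nat.card E) := by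
  have := isProbabilityMeasure_resample μ x
  have h := relEnt_nonneg (absContOn_resample μ hx)
  rw [relEnt_resample μ hx] at h
  rw [condEntropy]
  linarith

lemma condEntropy_anti [Nonempty E] (μ : Measure (Config d E)) [IsProbabilityMeasure μ]
    {x : Site d} {A B : Finset (Site d)} (hAB : A ⊆ B) (hx : x ∉ B) :
    condEntropy μ x B ≤ condEntropy μ x A := by
  have := isProbabilityMeasure_resample μ x
  have hxA : x ∉ A := fun h => hx (hAB h)
  have h := relEnt_mono (Finset.insert_subset_insert x hAB) (absContOn_resample μ hxA)
    (absContOn_resample μ hx)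
  rw [relEnt_resample μ hx, relEnt_resample μ hxA] at h
  rw [condEntropy, condEntropy]
  linarith

end

end LatticeGibbs

/-! ### Translations, averages along van Hove sequences, lexicographic telescoping -/

namespace LatticeGibbs

variable {d : ℕ} {E : Type*}

lemma mem_translate {Λ : Finset (Site d)} {x y : Site d} :
    y ∈ translate Λ x ↔ ∃ z ∈ Λ, z + x = y := by
  simp [translate]

lemma add_mem_translate {Λ : Finset (Site d)} {x y : Site d} :
    y + x ∈ translate Λ x ↔ y ∈ Λ := by
  simp [translate]

lemma translate_insert (x y : Site d) (Λ : Finset (Site d)) :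
    translate (insert y Λ) x = insert (y + x) (translate Λ x) := by
  simp [translate]

lemma translate_translate (x y : Site d) (Λ : Finset (Site d)) :
    translate (translate Λ x) y = translate Λ (x + y) := by
  ext z
  simp [mem_translate, add_assoc]

lemma translate_zero (Λ : Finset (Site d)) : translate Λ 0 = Λ := by
  ext z
  simp [mem_translate]

lemma translate_subset_translate {Δ Λ : Finset (Site d)} (h : Δ ⊆ Λ) (x : Site d) :
    translate Δ x ⊆ translate Λ x := Finset.map_subset_map.2 h

lemma translate_sdiff (Δ Λ : Finset (Site d)) (x : Site d) :
    translate (Λ \ Δ) x = translate Λ x \ translate Δ x := by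
  ext y
  obtain ⟨z, rfl⟩ : ∃ z, y = z + x := ⟨y - x, by simp⟩
  simp [add_mem_translate]

lemma shift_preimage_cylinderAt (Λ : Finset (Site d)) (x : Site d) (ω : Config d E) :
    shift x ⁻¹' cylinderAt Λ (shift x ω) = cylinderAt (translate Λ x) ω := by
  ext η
  simp only [Set.mem_preimage, mem_cylinderAt, shift, mem_translate, forall_exists_index, and_imp,
    forall_apply_eq_imp_iff₂, add_comm x]

lemma shift_bijective (x : Site d) : Function.Bijective (shift (E := E) x) := by
  refine Function.bijective_iff_has_inverse.2 ⟨shift (-x), fun ω => ?_, fun ω => ?_⟩ <;>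
  · ext y; simp [shift]

lemma shift_image_cylinderAt (Λ : Finset (Site d)) (x : Site d) (ω : Config d E) :
    shift x '' cylinderAt (translate Λ x) ω = cylinderAt Λ (shift x ω) := by
  rw [← shift_preimage_cylinderAt, Set.image_preimage_eq _ (shift_bijective x).surjective]

section VanHove

/-- A bad site x has some c ∈ C with c + x in (Λ + c) ∖ Λ, and for given c that point determines x.
-/
lemma card_filter_not_translate_subset_le (C Λ : Finset (Site d)) [DecidableEq (Site d)] :
    (Λ.filter fun x => ¬ translate C x ⊆ Λ).card ≤ ∑ c ∈ C, (translate Λ c \ Λ).card := by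
  calc (Λ.filter fun x => ¬ translate C x ⊆ Λ).card
      ≤ (C.biUnion fun c => (translate Λ c \ Λ).image fun y => y - c).card := by
        refine Finset.card_le_card fun x hx => ?_
        rw [Finset.mem_filter, Finset.not_subset] at hx
        obtain ⟨hx, y, hy, hyΛ⟩ := hx
        obtain ⟨c, hc, rfl⟩ := mem_translate.1 hy
        rw [Finset.mem_biUnion]
        refine ⟨c, hc, Finset.mem_image.2 ⟨c + x, ?_, by simp⟩⟩
        exact Finset.mem_sdiff.2 ⟨by rw [add_comm]; exact add_mem_translate.2 hx, hyΛ⟩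
    _ ≤ ∑ c ∈ C, ((translate Λ c \ Λ).image fun y => y - c).card := Finset.card_biUnion_le
    _ ≤ _ := Finset.sum_le_sum fun c _ => Finset.card_image_le

/-- Averages along a van Hove sequence of quantities `g Λ x` that are close to `L` whenever `x` is
far from the boundary of `Λ`. -/
lemma IsVanHove.tendsto_average {Λ : ℕ → Finset (Site d)} (hΛ : IsVanHove Λ)
    {g : Finset (Site d) → Site d → ℝ} {L M : ℝ} (hM : ∀ Λ, ∀ x ∈ Λ, |g Λ x - L| ≤ M)
    (hL : ∀ ε > 0, ∃ C : Finset (Site d), ∀ Λ, ∀ x ∈ Λ, translate C x ⊆ Λ → |g Λ x - L| ≤ ε) :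
    Tendsto (fun n => (∑ x ∈ Λ n, g (Λ n) x) / ((Λ n).card : ℝ)) atTop (𝓝 L) := by
  classical
  rw [Metric.tendsto_nhds]
  intro ε hε
  obtain ⟨C, hC⟩ := hL (ε / 2) (half_pos hε)
  have hM0 : 0 ≤ M := by
    obtain ⟨x, hx⟩ := hΛ.1 0
    exact (abs_nonneg _).trans (hM _ x hx)
  have hlim : Tendsto (fun n => M * ∑ c ∈ C,
      ((translate (Λ n) c \ Λ n).card : ℝ) / ((Λ n).card : ℝ)) atTop (𝓝 0) := by
    simpa using (tendsto_finsetSum C fun c _ => hΛ.2 c).const_mul M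
  filter_upwards [hlim.eventually_lt_const (half_pos hε)] with n hn
  have hcard : (0 : ℝ) < (Λ n).card := Nat.cast_pos.2 (Finset.card_pos.2 (hΛ.1 n))
  have h1 : (∑ x ∈ Λ n, g (Λ n) x) / ((Λ n).card : ℝ) - L =
      (∑ x ∈ Λ n, (g (Λ n) x - L)) / ((Λ n).card : ℝ) := by
    rw [Finset.sum_sub_distrib, Finset.sum_const, nsmul_eq_mul]
    field_simp
  -- Interior sites cost ε/2 each; the few sites near the boundary cost the crude bound M.
  have h2 : ∑ x ∈ Λ n, |g (Λ n) x - L| ≤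
      ∑ x ∈ Λ n, (ε / 2 + if ¬ translate C x ⊆ Λ n then M else 0) := by
    refine Finset.sum_le_sum fun x hx => ?_
    split_ifs with h
    · rw [add_zero]; exact hC _ x hx h
    · linarith [hM (Λ n) x hx]
  have h3 : ∑ x ∈ Λ n, (ε / 2 + if ¬ translate C x ⊆ Λ n then M else 0) ≤
      (Λ n).card * (ε / 2) + M * ∑ c ∈ C, ((translate (Λ n) c \ Λ n).card : ℝ) := by
    rw [Finset.sum_add_distrib, Finset.sum_const, nsmul_eq_mul, ← Finset.sum_filter,
      Finset.sum_const, nsmul_eq_mul, mul_comm _ M]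
    gcongr
    exact_mod_cast card_filter_not_translate_subset_le C (Λ n)
  rw [Real.dist_eq, h1, abs_div, abs_of_pos hcard, div_lt_iff₀ hcard]
  rw [← Finset.sum_div, ← mul_div_assoc, div_lt_iff₀ hcard] at hn
  calc |∑ x ∈ Λ n, (g (Λ n) x - L)| ≤ ∑ x ∈ Λ n, |g (Λ n) x - L| :=
        Finset.abs_sum_le_sum_abs _ _
    _ < ε * (Λ n).card := by linarith

end VanHove

/-- Telescoping of a set function along an ordering of a finite set. -/
lemma sum_insert_sub_filter_lt {ι α : Type*} [LinearOrder α] [DecidableEq ι] {f : ι → α}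
    (hf : Function.Injective f) (F : Finset ι → ℝ) (Λ : Finset ι) :
    ∑ x ∈ Λ, (F (insert x (Λ.filter fun y => f y < f x)) - F (Λ.filter fun y => f y < f x)) =
      F Λ - F ∅ := by
  induction Λ using Finset.induction_on_max_value f with
  | empty => simp
  | insert a s ha hs ih =>
    have hlt : ∀ y ∈ s, f y < f a := fun y hy =>
      lt_of_le_of_ne (hs y hy) fun h => ha (hf h ▸ hy)
    have h1 : (insert a s).filter (fun y => f y < f a) = s := by
      ext y
      simp only [Finset.mem_filter, Finset.mem_insert]
      constructor
      · rintro ⟨rfl | h, h'⟩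
        · exact absurd h' (lt_irrefl _)
        · exact h
      · exact fun h => ⟨Or.inr h, hlt y h⟩
    have h2 : ∀ x ∈ s, (insert a s).filter (fun y => f y < f x) =
        s.filter fun y => f y < f x := fun x hx => by
      rw [Finset.filter_insert, if_neg (not_lt.2 (hs x hx))]
    rw [Finset.sum_insert ha, h1, Finset.sum_congr rfl fun x hx => by rw [h2 x hx], ih]
    ring

open Classical in
/-- The sites of `Λ` preceding `x` in the lexicographic order. -/
noncomputable def before (Λ : Finset (Site d)) (x : Site d) : Finset (Site d) :=
  Λ.filter fun y => toLex y < toLex x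

lemma mem_before {Λ : Finset (Site d)} {x y : Site d} :
    y ∈ before Λ x ↔ y ∈ Λ ∧ toLex y < toLex x := by
  simp [before]

lemma sum_insert_sub_before (F : Finset (Site d) → ℝ) (Λ : Finset (Site d)) :
    ∑ x ∈ Λ, (F (insert x (before Λ x)) - F (before Λ x)) = F Λ - F ∅ := by
  convert sum_insert_sub_filter_lt (f := toLex) toLex.injective F Λ <;>
  · ext
    rw [mem_before, Finset.mem_filter]
    exact Iff.rfl

lemma toLex_add_lt_iff {x y z : Site d} : toLex (y + x) < toLex (z + x) ↔ toLex y < toLex z := by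
  rw [toLex_add, toLex_add, add_lt_add_iff_right]

/-! ### Existence of the entropy density -/

section Entropy

variable [MeasurableSpace E] [DiscreteMeasurableSpace E]

lemma measurable_shift (x : Site d) : Measurable (shift (E := E) x) :=
  measurable_pi_lambda _ fun _ => measurable_pi_apply _

lemma prob_translate {μ : Measure (Config d E)} {x : Site d} (hμ : μ.map (shift x) = μ)
    (Λ : Finset (Site d)) (ω : Config d E) :
    prob μ (translate Λ x) ω = prob μ Λ (shift x ω) := by
  rw [prob, prob, ← shift_preimage_cylinderAt, ← map_measureReal_apply (measurable_shift x)
    (measurableSet_cylinderAt _ _), hμ]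

variable [Finite E]

lemma integral_log_prob_translate {μ ν : Measure (Config d E)} {x : Site d}
    (hμ : μ.map (shift x) = μ) (hν : ν.map (shift x) = ν) (Λ : Finset (Site d)) :
    ∫ ω, Real.log (prob ν (translate Λ x) ω) ∂μ = ∫ ω, Real.log (prob ν Λ ω) ∂μ := by
  simp_rw [prob_translate hν]
  conv_rhs => rw [← hμ]
  rw [integral_map (measurable_shift x).aemeasurable
    (measurable_of_dependsOn (dependsOn_log_prob ν Λ)).aestronglyMeasurable]

lemma entropy_translate {μ : Measure (Config d E)} {x : Site d} (hμ : μ.map (shift x) = μ)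
    (Λ : Finset (Site d)) : entropy μ (translate Λ x) = entropy μ Λ := by
  rw [entropy, entropy, integral_log_prob_translate hμ hμ]

lemma relEnt_translate {μ ν : Measure (Config d E)} [IsProbabilityMeasure μ] {x : Site d}
    (hμ : μ.map (shift x) = μ) (hν : ν.map (shift x) = ν) (Λ : Finset (Site d)) :
    relEnt (translate Λ x) μ ν = relEnt Λ μ ν := by
  rw [relEnt_eq, relEnt_eq, entropy_translate hμ, integral_log_prob_translate hμ hν]

lemma condEntropy_translate {μ : Measure (Config d E)} {x : Site d} (hμ : μ.map (shift x) = μ)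
    (A : Finset (Site d)) : condEntropy μ x (translate A x) = condEntropy μ 0 A := by
  have : insert x (translate A x) = translate (insert 0 A) x := by
    rw [translate_insert, zero_add]
  rw [condEntropy, condEntropy, this, entropy_translate hμ, entropy_translate hμ]

/-- The entropy density of a translation-invariant measure: the infimum of the conditional
entropies of the spin at the origin given finitely many spins in its lexicographic past. -/
noncomputable def entropyDensity (μ : Measure (Config d E)) : ℝ :=
  ⨅ A : {A : Finset (Site d) // ∀ y ∈ A, toLex y < toLex (0 : Site d)}, condEntropy μ 0 A

lemma bddBelow_condEntropy (μ : Measure (Config d E)) [IsProbabilityMeasure μ] :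
    BddBelow (Set.range fun A : {A : Finset (Site d) // ∀ y ∈ A, toLex y < toLex (0 : Site d)} =>
      condEntropy μ 0 A) :=
  ⟨0, by rintro _ ⟨A, rfl⟩; exact condEntropy_nonneg _ _ _⟩

lemma entropyDensity_le (μ : Measure (Config d E)) [IsProbabilityMeasure μ] {A : Finset (Site d)}
    (hA : ∀ y ∈ A, toLex y < toLex (0 : Site d)) : entropyDensity μ ≤ condEntropy μ 0 A :=
  ciInf_le (bddBelow_condEntropy μ) ⟨A, hA⟩

lemma entropyDensity_nonneg (μ : Measure (Config d E)) [IsProbabilityMeasure μ] :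
    0 ≤ entropyDensity μ :=
  Real.iInf_nonneg fun _ => condEntropy_nonneg _ _ _

lemma notMem_before (Λ : Finset (Site d)) (x : Site d) : x ∉ before Λ x :=
  fun h => lt_irrefl _ (mem_before.1 h).2

lemma entropyDensity_le_condEntropy_before {μ : Measure (Config d E)} [IsProbabilityMeasure μ]
    {x : Site d} (hμ : μ.map (shift x) = μ) (Λ : Finset (Site d)) :
    entropyDensity μ ≤ condEntropy μ x (before Λ x) := by
  have h : before Λ x = translate (translate (before Λ x) (-x)) x := by
    rw [translate_translate, neg_add_cancel, translate_zero]
  rw [h, condEntropy_translate hμ]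
  refine entropyDensity_le μ fun y hy => ?_
  obtain ⟨z, hz, rfl⟩ := mem_translate.1 hy
  have := (mem_before.1 hz).2
  rw [← toLex_add_lt_iff (x := x)]
  simpa using this

/-- By the chain rule S_Λ is the sum of the entropies of the spins at x ∈ Λ given their predecessors
in Λ. Each term is at least the infimum, and is close to it once the predecessors contain the
translate to x of a nearly optimal finite past A. -/
theorem tendsto_entropy_div_card {μ : Measure (Config d E)} [IsProbabilityMeasure μ]
    (hμ : ∀ x, μ.map (shift x) = μ) {Λ : ℕ → Finset (Site d)} (hΛ : IsVanHove Λ) :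
    Tendsto (fun n => entropy μ (Λ n) / ((Λ n).card : ℝ)) atTop (𝓝 (entropyDensity μ)) := by
  have hE : Nonempty E := (nonempty_of_isProbabilityMeasure μ).map fun ω => ω 0
  have h := hΛ.tendsto_average (g := fun Λ x => condEntropy μ x (before Λ x))
    (L := entropyDensity μ) (M := Real.log (Nat.card E)) ?_ ?_
  · refine h.congr fun n => ?_
    simp only [condEntropy]
    rw [sum_insert_sub_before (entropy μ), entropy_empty, sub_zero]
  · intro Λ x _
    have h1 := entropyDensity_le_condEntropy_before (hμ x) Λ
    have h2 := condEntropy_le μ (notMem_before Λ x)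
    rw [abs_of_nonneg (sub_nonneg.2 h1)]
    linarith [entropyDensity_nonneg μ]
  · intro ε hε
    have : Nonempty {A : Finset (Site d) // ∀ y ∈ A, toLex y < toLex (0 : Site d)} :=
      ⟨⟨∅, by simp⟩⟩
    obtain ⟨⟨A, hA⟩, hAε⟩ := exists_lt_of_ciInf_lt
      (show entropyDensity μ < entropyDensity μ + ε by linarith)
    refine ⟨A, fun Λ x hx hxA => ?_⟩
    have h1 := entropyDensity_le_condEntropy_before (hμ x) Λ
    have hsub : translate A x ⊆ before Λ x := fun y hy => by
      refine mem_before.2 ⟨hxA hy, ?_⟩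
      obtain ⟨z, hz, rfl⟩ := mem_translate.1 hy
      have := (toLex_add_lt_iff (x := x)).2 (hA z hz)
      rwa [zero_add] at this
    have h2 := condEntropy_anti μ hsub (notMem_before Λ x)
    rw [condEntropy_translate (hμ x)] at h2
    simp only at hAε
    rw [abs_of_nonneg (sub_nonneg.2 h1)]
    linarith

end Entropy

end LatticeGibbs

/-! ### Patched configurations and uniform continuity -/

namespace LatticeGibbs

variable {d : ℕ} {E : Type*}

open Classical in
/-- The configuration equal to `σ` on `T` and to `η` off `T`. -/
noncomputable def patch (T : Set (Site d)) (σ η : Config d E) : Config d E :=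
  fun y => if y ∈ T then σ y else η y

lemma patch_of_mem {T : Set (Site d)} {y : Site d} (h : y ∈ T) (σ η : Config d E) :
    patch T σ η y = σ y := if_pos h

lemma patch_of_notMem {T : Set (Site d)} {y : Site d} (h : y ∉ T) (σ η : Config d E) :
    patch T σ η y = η y := if_neg h

lemma patch_apply_eq {T S : Set (Site d)} {y z : Site d} {σ σ' η η' : Config d E}
    (h : y ∈ T ↔ z ∈ S) (hσ : σ y = σ' z) (hη : η y = η' z) :
    patch T σ η y = patch S σ' η' z := by
  by_cases hy : y ∈ T
  · rw [patch_of_mem hy, patch_of_mem (h.1 hy), hσ]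
  · rw [patch_of_notMem hy, patch_of_notMem (fun hz => hy (h.2 hz)), hη]

/-- The sites preceding `x` in the lexicographic order. -/
def past (x : Site d) : Set (Site d) := {y | toLex y < toLex x}

lemma mem_past {x y : Site d} : y ∈ past x ↔ toLex y < toLex x := Iff.rfl

lemma add_mem_past {x y : Site d} : x + y ∈ past x ↔ y ∈ past 0 := by
  have := toLex_add_lt_iff (x := x) (y := y) (z := 0)
  rwa [zero_add, add_comm] at this

section UniformContinuity

variable [TopologicalSpace E] [DiscreteTopology E]

lemma isOpen_cylinderAt (Λ : Finset (Site d)) (σ : Config d E) : IsOpen (cylinderAt Λ σ) := by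
  rw [cylinderAt_eq_biInter]
  exact isOpen_biInter_finset fun x _ => (isOpen_discrete {σ x}).preimage (continuous_apply x)

lemma exists_cylinderAt_subset {U : Set (Config d E)} (hU : IsOpen U) {σ : Config d E}
    (hσ : σ ∈ U) : ∃ Λ : Finset (Site d), cylinderAt Λ σ ⊆ U := by
  obtain ⟨I, u, hu, hIU⟩ := isOpen_pi_iff.1 hU σ hσ
  refine ⟨I, fun η hη => hIU fun i hi => ?_⟩
  rw [hη i hi]
  exact (hu i hi).2

/-- Uniform continuity of continuous functions of the configuration. -/
lemma exists_finset_forall_abs_sub_le [Finite E] {g : Config d E → ℝ} (hg : Continuous g) {ε : ℝ}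
    (hε : 0 < ε) : ∃ C : Finset (Site d), ∀ σ, ∀ η ∈ cylinderAt C σ, |g η - g σ| ≤ ε := by
  classical
  have h : ∀ σ, ∃ C : Finset (Site d), ∀ η ∈ cylinderAt C σ, |g η - g σ| < ε / 2 := fun σ =>
    exists_cylinderAt_subset (U := {η | |g η - g σ| < ε / 2})
      (isOpen_lt (by fun_prop) continuous_const) (by simpa using hε)
  choose C hC using h
  -- Compactness of Ω: finitely many of these cylinders cover, and the union of their bases serves
  -- for every σ.
  obtain ⟨t, ht⟩ := CompactSpace.elim_nhds_subcover (fun σ : Config d E => cylinderAt (C σ) σ)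
    fun σ => (isOpen_cylinderAt _ _).mem_nhds (self_mem_cylinderAt _ _)
  refine ⟨t.biUnion C, fun σ η hη => ?_⟩
  obtain ⟨ζ, hζ, hσ⟩ : ∃ ζ ∈ t, σ ∈ cylinderAt (C ζ) ζ := by
    have : σ ∈ ⋃ x ∈ t, cylinderAt (C x) x := ht ▸ Set.mem_univ σ
    simpa using this
  have hη' : η ∈ cylinderAt (C ζ) ζ := fun x hx =>
    (hη x (Finset.mem_biUnion.2 ⟨ζ, hζ, hx⟩)).trans (hσ x hx)
  have h1 := abs_lt.1 (hC ζ σ hσ)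
  have h2 := abs_lt.1 (hC ζ η hη')
  rw [abs_le]
  constructor <;> linarith [h1.1, h1.2, h2.1, h2.2]

lemma continuous_patch (T : Set (Site d)) (σ : Config d E) : Continuous (patch T σ) := by
  refine continuous_pi fun y => ?_
  by_cases h : y ∈ T
  · simp only [patch_of_mem h]; exact continuous_const
  · simp only [patch_of_notMem h]; exact continuous_apply y

end UniformContinuity

/-! ### Resampling by the kernels, and the Gibbs property as invariance -/

section Kernel

variable [MeasurableSpace E]

lemma mem_iff_of_measurableSet_cylinderEvents {s : Set (Site d)} {B : Set (Config d E)}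
    (hB : MeasurableSet[cylinderEvents (X := fun _ : Site d => E) s] B) {ω η : Config d E}
    (h : ∀ x ∈ s, ω x = η x) : ω ∈ B ↔ η ∈ B := by
  -- The preimages of arbitrary sets under restriction to s form a σ-algebra containing the
  -- generators.
  have hle : cylinderEvents (X := fun _ : Site d => E) s ≤
      MeasurableSpace.comap (s.domRestrict : Config d E → (s → E)) ⊤ := by
    refine iSup₂_le fun i hi => ?_
    rintro _ ⟨t, -, rfl⟩
    exact ⟨(fun f : s → E => f ⟨i, hi⟩) ⁻¹' t, trivial, rfl⟩
  obtain ⟨C, -, rfl⟩ := hle _ hB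
  have : s.domRestrict ω = s.domRestrict η := funext fun x => h x x.2
  simp [this]

namespace Specification

variable (γ : Specification d E)

lemma measurable_ker (Λ : Finset (Site d)) : Measurable fun ω => γ.ker Λ ω :=
  (γ.ker Λ).measurable.mono cylinderEvents_le_pi le_rfl

lemma ker_congr {Λ : Finset (Site d)} {ω η : Config d E} (h : ∀ x ∉ Λ, ω x = η x) :
    γ.ker Λ ω = γ.ker Λ η := by
  ext A hA
  have hm : Measurable[cylinderEvents (X := fun _ : Site d => E) ((Λ : Set (Site d))ᶜ)]
      fun ω => γ.ker Λ ω A := Kernel.measurable_coe _ hA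
  have := mem_iff_of_measurableSet_cylinderEvents (hm (measurableSet_singleton (γ.ker Λ η A)))
    (ω := ω) (η := η) (fun x hx => h x (by simpa using hx))
  simpa using this

/-- The measure `μ γ_Λ`, obtained from `μ` by resampling in `Λ` according to `γ_Λ`. -/
noncomputable def update (Λ : Finset (Site d)) (μ : Measure (Config d E)) :
    Measure (Config d E) := μ.bind fun ω => γ.ker Λ ω

lemma update_apply (Λ : Finset (Site d)) (μ : Measure (Config d E)) {A : Set (Config d E)}
    (hA : MeasurableSet A) : γ.update Λ μ A = ∫⁻ ω, γ.ker Λ ω A ∂μ :=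
  Measure.bind_apply hA (γ.measurable_ker Λ).aemeasurable

lemma isProbabilityMeasure_update (Λ : Finset (Site d)) (μ : Measure (Config d E))
    [IsProbabilityMeasure μ] : IsProbabilityMeasure (γ.update Λ μ) := by
  constructor
  have := γ.isProbability Λ
  simp [update_apply γ Λ μ MeasurableSet.univ]

lemma update_inter (Λ : Finset (Site d)) (μ : Measure (Config d E)) {A B : Set (Config d E)}
    (hA : MeasurableSet A)
    (hB : MeasurableSet[cylinderEvents (X := fun _ : Site d => E) ((Λ : Set (Site d))ᶜ)] B) :
    γ.update Λ μ (A ∩ B) = ∫⁻ ω in B, γ.ker Λ ω A ∂μ :=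
  ((γ.proper Λ).setLIntegral_eq_comp cylinderEvents_le_pi hA hB).symm

lemma measurable_ker_real (Λ : Finset (Site d)) {A : Set (Config d E)} (hA : MeasurableSet A) :
    Measurable fun ω => (γ.ker Λ ω).real A :=
  ((Measure.measurable_coe hA).comp (γ.measurable_ker Λ)).ennreal_toReal

lemma integrable_ker_real (Λ : Finset (Site d)) {A : Set (Config d E)} (hA : MeasurableSet A)
    (μ : Measure (Config d E)) [IsFiniteMeasure μ] :
    Integrable (fun ω => (γ.ker Λ ω).real A) μ := by
  have := γ.isProbability Λ
  refine Integrable.of_bound (γ.measurable_ker_real Λ hA).aestronglyMeasurable 1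
    (Eventually.of_forall fun ω => ?_)
  rw [Real.norm_of_nonneg measureReal_nonneg]
  exact measureReal_le_one

lemma setIntegral_ker_real (Λ : Finset (Site d)) (μ : Measure (Config d E)) [IsFiniteMeasure μ]
    {A B : Set (Config d E)} (hA : MeasurableSet A)
    (hB : MeasurableSet[cylinderEvents (X := fun _ : Site d => E) ((Λ : Set (Site d))ᶜ)] B) :
    ∫ ω in B, (γ.ker Λ ω).real A ∂μ = (γ.update Λ μ).real (A ∩ B) := by
  have := γ.isProbability Λ
  rw [measureReal_def, γ.update_inter Λ μ hA hB]
  exact integral_toReal ((Measure.measurable_coe hA).comp (γ.measurable_ker Λ)).aemeasurable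
    (Eventually.of_forall fun ω => measure_lt_top _ _)

/-- Integrating the conditional probability gives invariance. Conversely, properness turns
invariance on A ∩ B, with B ∈ 𝓕_{Λᶜ}, into the defining identity of the conditional expectation. -/
theorem mem_gibbs_iff {μ : ProbabilityMeasure (Config d E)} :
    μ ∈ γ.gibbs ↔ ∀ Λ, γ.update Λ (μ : Measure (Config d E)) = μ := by
  constructor
  · intro h Λ
    have := γ.isProbabilityMeasure_update Λ (μ : Measure (Config d E))
    ext A hA
    rw [← measureReal_eq_measureReal_iff]
    have h1 := γ.setIntegral_ker_real Λ (μ : Measure (Config d E)) hA (B := Set.univ)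
      MeasurableSet.univ
    rw [Set.inter_univ, setIntegral_univ] at h1
    rw [← h1]
    have h2 := integral_congr_ae (h Λ A hA)
    rw [integral_condExp cylinderEvents_le_pi] at h2
    exact h2.symm.trans (integral_indicator_one hA)
  · intro h Λ A hA
    refine (ae_eq_condExp_of_forall_setIntegral_eq cylinderEvents_le_pi
      ((integrable_indicator_iff hA).2 (integrable_const _).integrableOn)
      (fun s _ _ => (γ.integrable_ker_real Λ hA _).integrableOn) ?_ ?_).symm
    · intro B hB _
      have := γ.setIntegral_ker_real Λ (μ : Measure (Config d E)) hA hB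
      rw [h Λ] at this
      refine this.trans ?_
      rw [setIntegral_indicator hA]
      simp [Set.inter_comm]
    · have hm : Measurable[cylinderEvents (X := fun _ : Site d => E) ((Λ : Set (Site d))ᶜ)]
        fun ω => (γ.ker Λ ω A).toReal := (Kernel.measurable_coe _ hA).ennreal_toReal
      exact hm.stronglyMeasurable.aestronglyMeasurable

/-- The probability `γ_Δ(ω_Δ | ω)`. -/
noncomputable def selfProb (Δ : Finset (Site d)) (ω : Config d E) : ℝ :=
  (γ.ker Δ ω).real (cylinderAt Δ ω)

/-- The kernel sees only η off Δ and the cylinder only σ on Δ, so one patched configuration carries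
both arguments. -/
lemma ker_real_cylinderAt (Δ : Finset (Site d)) (σ η : Config d E) :
    (γ.ker Δ η).real (cylinderAt Δ σ) = γ.selfProb Δ (patch Δ σ η) := by
  rw [selfProb, ← γ.ker_congr (fun x hx => (patch_of_notMem (T := (Δ : Set (Site d)))
    (by simpa using hx) σ η).symm), cylinderAt_congr fun x hx => patch_of_mem (by simpa using hx) σ η]

lemma selfProb_le_one (Δ : Finset (Site d)) (ω : Config d E) : γ.selfProb Δ ω ≤ 1 := by
  have := γ.isProbability Δ ω
  exact measureReal_le_one

variable {γ} in
lemma IsNonnull.exists_le_selfProb (h : γ.IsNonnull) (Δ : Finset (Site d)) :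
    ∃ a : ℝ, 0 < a ∧ ∀ ω, a ≤ γ.selfProb Δ ω := by
  rcases Δ.eq_empty_or_nonempty with rfl | hΔ
  · refine ⟨1, one_pos, fun ω => ?_⟩
    have := γ.isProbability ∅ ω
    have hu : cylinderAt ∅ ω = Set.univ := by ext; simp [mem_cylinderAt]
    simp [selfProb, hu]
  · obtain ⟨a, b, ha, hab, hb, hle, -⟩ := h Δ hΔ
    have hat : a ≠ ∞ := (hab.trans hb).ne_top
    refine ⟨a.toReal, ENNReal.toReal_pos ha.ne' hat, fun ω => ?_⟩
    have := γ.isProbability Δ ω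
    exact ENNReal.toReal_mono (measure_ne_top _ _) (hle.le.trans (iInf₂_le (f := fun σ η => γ.ker Δ η (cylinderAt Δ σ)) ω ω))

variable {γ} in
lemma IsNonnull.selfProb_pos (h : γ.IsNonnull) (Δ : Finset (Site d)) (ω : Config d E) :
    0 < γ.selfProb Δ ω := by
  obtain ⟨a, ha, hle⟩ := h.exists_le_selfProb Δ
  exact ha.trans_le (hle ω)

variable {γ} in
lemma IsNonnull.exists_abs_log_selfProb_le (h : γ.IsNonnull) (Δ : Finset (Site d)) :
    ∃ M : ℝ, ∀ ω, |Real.log (γ.selfProb Δ ω)| ≤ M := by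
  obtain ⟨a, ha, hle⟩ := h.exists_le_selfProb Δ
  refine ⟨-Real.log a, fun ω => ?_⟩
  rw [abs_of_nonpos (Real.log_nonpos (ha.le.trans (hle ω)) (γ.selfProb_le_one Δ ω)), neg_le_neg_iff]
  exact Real.log_le_log ha (hle ω)

variable {γ} in
lemma IsTranslationInvariant.selfProb_translate [DiscreteMeasurableSpace E]
    (h : γ.IsTranslationInvariant) (Δ : Finset (Site d)) (x : Site d) (ω : Config d E) :
    γ.selfProb (translate Δ x) ω = γ.selfProb Δ (shift x ω) := by
  rw [selfProb, selfProb, measureReal_def, h x Δ ω _ (measurableSet_cylinderAt _ _),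
    shift_image_cylinderAt, measureReal_def]

variable {γ} in
lemma IsTranslationInvariant.selfProb_singleton [DiscreteMeasurableSpace E]
    (h : γ.IsTranslationInvariant) (x : Site d) (ω : Config d E) :
    γ.selfProb {x} ω = γ.selfProb {0} (shift x ω) := by
  have : translate {0} x = {x} := by simp [translate]
  rw [← h.selfProb_translate, this]

variable [DiscreteMeasurableSpace E]

variable {γ} in
-- The configuration enters twice, but near σ the cylinder is constant, which leaves γ_Δ applied to
-- a fixed local indicator.
lemma IsQuasilocal.continuous_selfProb [TopologicalSpace E] [DiscreteTopology E]
    (h : γ.IsQuasilocal) (Δ : Finset (Site d)) : Continuous (γ.selfProb Δ) := by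
  rw [continuous_iff_continuousAt]
  intro σ
  have hc : Continuous fun ω => (γ.ker Δ ω).real (cylinderAt Δ σ) := by
    have := h Δ ((cylinderAt Δ σ).indicator 1) ⟨Δ, Measurable.indicator
      (m := cylinderEvents (X := fun _ : Site d => E) (Δ : Set (Site d))) measurable_const
      (measurableSet_cylinderEvents_cylinderAt subset_rfl σ)⟩
    simpa only [integral_indicator_one (measurableSet_cylinderAt Δ σ)] using this
  refine hc.continuousAt.congr ?_
  filter_upwards [(isOpen_cylinderAt Δ σ).mem_nhds (self_mem_cylinderAt Δ σ)] with η hη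
  rw [selfProb, cylinderAt_congr hη]

variable {γ} in
lemma IsQuasilocal.continuous_log_selfProb [TopologicalSpace E] [DiscreteTopology E]
    (h : γ.IsQuasilocal) (hn : γ.IsNonnull) (Δ : Finset (Site d)) :
    Continuous fun ω => Real.log (γ.selfProb Δ ω) :=
  (h.continuous_selfProb Δ).log fun ω => (hn.selfProb_pos Δ ω).ne'

lemma prob_update {Δ Λ : Finset (Site d)} (hΔ : Δ ⊆ Λ) (μ : Measure (Config d E))
    [IsFiniteMeasure μ] (σ : Config d E) :
    prob (γ.update Δ μ) Λ σ = ∫ η in cylinderAt (Λ \ Δ) σ, γ.selfProb Δ (patch Δ σ η) ∂μ := by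
  simp_rw [← γ.ker_real_cylinderAt]
  rw [γ.setIntegral_ker_real Δ μ (measurableSet_cylinderAt _ _)
    (measurableSet_cylinderEvents_cylinderAt (fun x hx => by simp_all) σ),
    ← cylinderAt_union, Finset.union_sdiff_of_subset hΔ, prob]

variable {γ} in
/-- If `γ_Δ(ζ_Δ | ζ)` varies little on the cylinder of `σ` on `Λ`, then the conditional probability
of `σ_Δ` given `σ_{Λ∖Δ}` after resampling in `Δ` is close to `γ_Δ(σ_Δ | σ)`. -/
lemma IsNonnull.prob_update_pos_and_abs_log_le (hn : γ.IsNonnull) {Δ Λ : Finset (Site d)}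
    (hΔ : Δ ⊆ Λ)
    (μ : Measure (Config d E)) [IsProbabilityMeasure μ] {σ : Config d E}
    (hpos : 0 < prob μ (Λ \ Δ) σ) {ε : ℝ}
    (hε : ∀ ζ ∈ cylinderAt Λ σ,
      |Real.log (γ.selfProb Δ ζ) - Real.log (γ.selfProb Δ σ)| ≤ ε) :
    0 < prob (γ.update Δ μ) Λ σ ∧
    |Real.log (prob (γ.update Δ μ) Λ σ) - Real.log (prob μ (Λ \ Δ) σ)
      - Real.log (γ.selfProb Δ σ)| ≤ ε := by
  have hB := measurableSet_cylinderAt (Λ \ Δ) σ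
  have ha := hn.selfProb_pos Δ σ
  -- Pointwise bounds on the integrand of `prob_update`, to be integrated over the cylinder on Λ ∖
  -- Δ.
  have hbd : ∀ η ∈ cylinderAt (Λ \ Δ) σ,
      γ.selfProb Δ σ * Real.exp (-ε) ≤ γ.selfProb Δ (patch Δ σ η) ∧
      γ.selfProb Δ (patch Δ σ η) ≤ γ.selfProb Δ σ * Real.exp ε := by
    intro η hη
    have hmem : patch Δ σ η ∈ cylinderAt Λ σ := fun x hx => by
      by_cases h : x ∈ Δ
      · exact patch_of_mem (by simpa using h) σ η
      · rw [patch_of_notMem (by simpa using h)]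
        exact hη x (Finset.mem_sdiff.2 ⟨hx, h⟩)
    have h1 := abs_le.1 (hε _ hmem)
    have h2 := hn.selfProb_pos Δ (patch Δ σ η)
    constructor
    · rw [← Real.log_le_log_iff (mul_pos ha (Real.exp_pos _)) h2,
        Real.log_mul ha.ne' (Real.exp_pos _).ne', Real.log_exp]
      linarith [h1.1]
    · rw [← Real.log_le_log_iff h2 (mul_pos ha (Real.exp_pos _)),
        Real.log_mul ha.ne' (Real.exp_pos _).ne', Real.log_exp]
      linarith [h1.2]
  have hint : IntegrableOn (fun η => γ.selfProb Δ (patch Δ σ η)) (cylinderAt (Λ \ Δ) σ) μ := by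
    simp_rw [← γ.ker_real_cylinderAt]
    exact (γ.integrable_ker_real Δ (measurableSet_cylinderAt _ _) μ).integrableOn
  have hconst : ∀ c : ℝ, IntegrableOn (fun _ : Config d E => c) (cylinderAt (Λ \ Δ) σ) μ :=
    fun c => integrable_const c
  have hlow : prob μ (Λ \ Δ) σ * (γ.selfProb Δ σ * Real.exp (-ε)) ≤
      prob (γ.update Δ μ) Λ σ := by
    rw [γ.prob_update hΔ, prob, ← smul_eq_mul (a := μ.real _), ← setIntegral_const]
    exact setIntegral_mono_on (hconst _) hint hB fun η hη => (hbd η hη).1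
  have hup : prob (γ.update Δ μ) Λ σ ≤
      prob μ (Λ \ Δ) σ * (γ.selfProb Δ σ * Real.exp ε) := by
    rw [γ.prob_update hΔ, prob, ← smul_eq_mul (a := μ.real _), ← setIntegral_const]
    exact setIntegral_mono_on hint (hconst _) hB fun η hη => (hbd η hη).2
  have hl : ∀ t : ℝ, Real.log (prob μ (Λ \ Δ) σ * (γ.selfProb Δ σ * Real.exp t)) =
      Real.log (prob μ (Λ \ Δ) σ) + (Real.log (γ.selfProb Δ σ) + t) := fun t => by
    rw [Real.log_mul hpos.ne' (mul_pos ha (Real.exp_pos _)).ne',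
      Real.log_mul ha.ne' (Real.exp_pos _).ne', Real.log_exp]
  have hp : 0 < prob (γ.update Δ μ) Λ σ :=
    (mul_pos hpos (mul_pos ha (Real.exp_pos _))).trans_le hlow
  refine ⟨hp, ?_⟩
  have h1 := Real.log_le_log (mul_pos hpos (mul_pos ha (Real.exp_pos _))) hlow
  have h2 := Real.log_le_log hp hup
  rw [hl] at h1 h2
  rw [abs_le]
  constructor <;> linarith

variable {γ} in
-- Resampling all of Λ leaves only the empty cylinder, of mass 1. The crude oscillation bound `M +
-- M` suffices, as only positivity is used.
lemma IsNonnull.prob_pos (hn : γ.IsNonnull) {ν : Measure (Config d E)} [IsProbabilityMeasure ν]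
    (hν : ∀ Λ, γ.update Λ ν = ν) (Λ : Finset (Site d)) (σ : Config d E) : 0 < prob ν Λ σ := by
  obtain ⟨M, hM⟩ := hn.exists_abs_log_selfProb_le Λ
  have := (hn.prob_update_pos_and_abs_log_le (Finset.Subset.refl Λ) ν (σ := σ) (ε := M + M)
    (by rw [Finset.sdiff_self, prob_empty]; exact one_pos)
    (fun ζ _ => (abs_sub _ _).trans (add_le_add (hM _) (hM _)))).1
  rwa [hν] at this

/-! ### The energy density from single-site kernels -/

section Energy

variable [TopologicalSpace E] [DiscreteTopology E] [Finite E]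

/-- The energy cost at the origin of replacing the spin by `o`, when all spins in the
lexicographic past have already been replaced by `o`. -/
noncomputable def flipEnergy (o ω : Config d E) : ℝ :=
  Real.log (γ.selfProb {0} (patch (past 0) o ω)) -
    Real.log (γ.selfProb {0} (patch (insert 0 (past 0)) o ω))

variable {γ}

lemma continuous_flipEnergy (hn : γ.IsNonnull) (hq : γ.IsQuasilocal) (o : Config d E) :
    Continuous (γ.flipEnergy o) :=
  ((hq.continuous_log_selfProb hn {0}).comp (continuous_patch _ o)).sub
    ((hq.continuous_log_selfProb hn {0}).comp (continuous_patch _ o))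

lemma integrable_flipEnergy (hn : γ.IsNonnull) (hq : γ.IsQuasilocal) (o : Config d E)
    (μ : Measure (Config d E)) [IsFiniteMeasure μ] : Integrable (γ.flipEnergy o) μ := by
  obtain ⟨M, hM⟩ := hn.exists_abs_log_selfProb_le {0}
  exact Integrable.of_bound (continuous_flipEnergy hn hq o).aestronglyMeasurable (M + M)
    (Eventually.of_forall fun ω => (norm_sub_le _ _).trans (add_le_add (hM _) (hM _)))

lemma dependsOn_log_prob_patch (ν : Measure (Config d E)) (Λ : Finset (Site d))
    (T : Set (Site d)) (o : Config d E) :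
    DependsOn (fun ω => Real.log (prob ν Λ (patch T o ω))) (Λ : Set (Site d)) := by
  intro ω η h
  simp only
  rw [prob_congr ν fun x hx => ?_]
  simp only [patch, h x hx]

/-- The two patched configurations agree off x, so their ν-probabilities on Λ ∖ {x} cancel. What
remains is a difference of two conditional log-probabilities, each within δ of the kernel's. -/
lemma abs_log_prob_patch_sub_flipEnergy_le (hn : γ.IsNonnull) (hi : γ.IsTranslationInvariant)
    {ν : Measure (Config d E)} [IsProbabilityMeasure ν] (hν : ∀ Λ, γ.update Λ ν = ν) (e : E)
    {Λ : Finset (Site d)} {x : Site d} (hx : x ∈ Λ) {δ : ℝ}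
    (hδ : ∀ σ : Config d E, ∀ ζ ∈ cylinderAt Λ σ,
      |Real.log (γ.selfProb {x} ζ) - Real.log (γ.selfProb {x} σ)| ≤ δ) (ω : Config d E) :
    |Real.log (prob ν Λ (patch (past x) (fun _ => e) ω)) -
      Real.log (prob ν Λ (patch (insert x (past x)) (fun _ => e) ω)) -
      γ.flipEnergy (fun _ => e) (shift x ω)| ≤ 2 * δ := by
  have hs : ∀ σ, |Real.log (prob ν Λ σ) - Real.log (prob ν (Λ \ {x}) σ)
      - Real.log (γ.selfProb {x} σ)| ≤ δ := fun σ => by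
    have := (hn.prob_update_pos_and_abs_log_le (Finset.singleton_subset_iff.2 hx) ν
      (hn.prob_pos hν _ σ) (hδ σ)).2
    rwa [hν] at this
  have h1 := abs_le.1 (hs (patch (past x) (fun _ => e) ω))
  have h2 := abs_le.1 (hs (patch (insert x (past x)) (fun _ => e) ω))
  have heq : prob ν (Λ \ {x}) (patch (past x) (fun _ => e) ω) =
      prob ν (Λ \ {x}) (patch (insert x (past x)) (fun _ => e) ω) := by
    refine prob_congr ν fun y hy => ?_
    have hne : y ≠ x := fun h => (Finset.mem_sdiff.1 hy).2 (Finset.mem_singleton.2 h)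
    exact patch_apply_eq (by simp [hne]) rfl rfl
  have hshift1 : shift x (patch (past x) (fun _ => e) ω) =
      patch (past 0) (fun _ => e) (shift x ω) :=
    funext fun y => patch_apply_eq add_mem_past rfl rfl
  have hshift2 : shift x (patch (insert x (past x)) (fun _ => e) ω) =
      patch (insert 0 (past 0)) (fun _ => e) (shift x ω) :=
    funext fun y => patch_apply_eq (by simp [add_mem_past]) rfl rfl
  rw [hi.selfProb_singleton, hshift1] at h1
  rw [hi.selfProb_singleton, hshift2, ← heq] at h2
  rw [flipEnergy, abs_le]
  constructor <;> linarith [h1.1, h1.2, h2.1, h2.2]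

/-- The mean energy difference between a configuration and the constant configuration, per site,
along a van Hove sequence. -/
theorem tendsto_integral_log_prob_sub_div_card (hn : γ.IsNonnull)
    (hi : γ.IsTranslationInvariant) (hq : γ.IsQuasilocal)
    {ν : Measure (Config d E)} [IsProbabilityMeasure ν] (hν : ∀ Λ, γ.update Λ ν = ν)
    {μ : Measure (Config d E)} [IsProbabilityMeasure μ] (hμ : ∀ x, μ.map (shift x) = μ) (e : E)
    {Λ : ℕ → Finset (Site d)} (hΛ : IsVanHove Λ) :
    Tendsto (fun n => (∫ ω, Real.log (prob ν (Λ n) ω) ∂μ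
      - Real.log (prob ν (Λ n) fun _ => e)) / ((Λ n).card : ℝ)) atTop
      (𝓝 (∫ ω, γ.flipEnergy (fun _ => e) ω ∂μ)) := by
  set o : Config d E := fun _ => e with ho
  set F : Finset (Site d) → Set (Site d) → ℝ := fun Λ T =>
    ∫ ω, Real.log (prob ν Λ (patch T o ω)) ∂μ with hF
  have hint : ∀ Λ T, Integrable (fun ω => Real.log (prob ν Λ (patch T o ω))) μ := fun Λ T =>
    integrable_of_dependsOn μ (dependsOn_log_prob_patch ν Λ T o)
  have hg : ∀ (Λ : Finset (Site d)) (x : Site d), x ∈ Λ → ∀ δ : ℝ,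
      (∀ σ : Config d E, ∀ ζ ∈ cylinderAt Λ σ,
        |Real.log (γ.selfProb {x} ζ) - Real.log (γ.selfProb {x} σ)| ≤ δ) →
      |F Λ (past x) - F Λ (insert x (past x)) -
        ∫ ω, γ.flipEnergy o ω ∂μ| ≤ 2 * δ := by
    intro Λ x hx δ hδ
    have hi2 : Integrable (fun ω => γ.flipEnergy o (shift x ω)) μ := by
      have := integrable_flipEnergy hn hq o (μ.map (shift x))
      exact this.comp_measurable (measurable_shift x)
    have h1 : ∫ ω, γ.flipEnergy o ω ∂μ = ∫ ω, γ.flipEnergy o (shift x ω) ∂μ := by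
      conv_lhs => rw [← hμ x]
      rw [integral_map (measurable_shift x).aemeasurable
        (continuous_flipEnergy hn hq o).aestronglyMeasurable]
    rw [h1, ← integral_sub (hint _ _) (hint _ _), 
      ← integral_sub (by exact (hint _ _).sub (hint _ _)) hi2]
    have := norm_integral_le_of_norm_le_const (μ := μ) (C := 2 * δ)
      (f := fun ω => Real.log (prob ν Λ (patch (past x) o ω)) -
        Real.log (prob ν Λ (patch (insert x (past x)) o ω)) - γ.flipEnergy o (shift x ω)) (Eventually.of_forall fun ω =>
      abs_log_prob_patch_sub_flipEnergy_le hn hi hν e hx hδ ω)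
    simpa using this
  obtain ⟨M, hM⟩ := hn.exists_abs_log_selfProb_le ({0} : Finset (Site d))
  have h := hΛ.tendsto_average
    (g := fun Λ x => F Λ (past x) - F Λ (insert x (past x)))
    (L := ∫ ω, γ.flipEnergy o ω ∂μ) (M := 2 * (M + M)) ?_ ?_
  · refine h.congr fun n => ?_
    have hlt : ∀ Λ x, F Λ (past x) = F Λ (before Λ x) := fun Λ x => by
      refine integral_congr_ae (Eventually.of_forall fun ω => ?_)
      simp only
      rw [prob_congr ν fun y hy => patch_apply_eq ?_ rfl rfl]
      simp [mem_past, mem_before, hy]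
    have hle : ∀ Λ x, F Λ (insert x (past x)) =
        F Λ (insert x (before Λ x) : Finset (Site d)) := fun Λ x => by
      refine integral_congr_ae (Eventually.of_forall fun ω => ?_)
      simp only
      rw [prob_congr ν fun y hy => patch_apply_eq ?_ rfl rfl]
      simp [mem_past, mem_before, hy]
    -- The sign makes the sum run from full replacement, log ν(e_Λ), to none, ∫ log ν_Λ dμ.
    have hsum := sum_insert_sub_before (fun T => -F (Λ n) T) (Λ n)
    rw [Finset.sum_congr rfl fun x hx => by rw [hlt, hle, ← neg_sub_neg], hsum]
    have h0 : F (Λ n) (∅ : Finset (Site d)) = ∫ ω, Real.log (prob ν (Λ n) ω) ∂μ := by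
      have : ∀ ω : Config d E, patch ((∅ : Finset (Site d)) : Set (Site d)) o ω = ω := fun ω =>
        funext fun y => patch_of_notMem (by simp) o ω
      simp only [hF, this]
    have h1 : F (Λ n) (Λ n) = Real.log (prob ν (Λ n) o) := by
      have : ∀ ω, prob ν (Λ n) (patch (Λ n) o ω) = prob ν (Λ n) o := fun ω =>
        prob_congr ν fun x hx => patch_of_mem (by simpa using hx) _ _
      simp [hF, this]
    rw [h0, h1]
    congr 1
    ring
  · intro Λ x hx
    refine hg Λ x hx _ fun σ ζ _ => ?_
    rw [hi.selfProb_singleton x ζ, hi.selfProb_singleton x σ]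
    exact (abs_sub _ _).trans (add_le_add (hM _) (hM _))
  · intro ε hε
    obtain ⟨C, hC⟩ := exists_finset_forall_abs_sub_le (hq.continuous_log_selfProb hn {0})
      (half_pos hε)
    -- If x + C lies in Λ, agreement on Λ becomes, after shifting by x, agreement on C.
    refine ⟨C, fun Λ x hx hxC => ?_⟩
    have := hg Λ x hx (ε / 2) (fun σ ζ hζ => by
      rw [hi.selfProb_singleton x ζ, hi.selfProb_singleton x σ]
      refine hC _ _ fun y hy => ?_
      have hmem := hxC (add_mem_translate.2 hy)
      rw [add_comm] at hmem
      exact hζ _ hmem)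
    linarith

end Energy

end Specification

end Kernel

end LatticeGibbs

namespace LatticeGibbs

variable {d : ℕ} {E : Type*}

/-! ### Cubes form a van Hove sequence -/

section Cube

lemma mem_cube {n : ℕ} {y : Site d} : y ∈ cube d n ↔ ∀ i, -(n : ℤ) ≤ y i ∧ y i ≤ n := by
  simp [cube, Pi.le_def, forall_and]

lemma card_cube (d n : ℕ) : (cube d n).card = (2 * n + 1) ^ d := by
  rw [cube, Pi.card_Icc]
  simp only [Int.card_Icc, Finset.prod_const, Finset.card_univ, Fintype.card_fin]
  congr 1
  omega

lemma cube_nonempty (d n : ℕ) : (cube d n).Nonempty :=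
  ⟨0, mem_cube.2 fun i => by simp⟩

lemma cube_mono {m n : ℕ} (h : m ≤ n) : cube d m ⊆ cube d n := fun y hy =>
  mem_cube.2 fun i => by
    have := mem_cube.1 hy i
    omega

lemma exists_subset_cube (Λ : Finset (Site d)) : ∃ k, Λ ⊆ cube d k := by
  refine ⟨Λ.sup fun y => Finset.univ.sup fun i => (y i).natAbs, fun y hy => mem_cube.2 fun i => ?_⟩
  have h1 : (y i).natAbs ≤ Finset.univ.sup fun i => (y i).natAbs :=
    Finset.le_sup (f := fun i => (y i).natAbs) (Finset.mem_univ i)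
  have h2 := Finset.le_sup (f := fun y : Site d => Finset.univ.sup fun i => (y i).natAbs) hy
  omega

lemma tendsto_cube_ratio (d k : ℕ) :
    Tendsto (fun n : ℕ => ((2 * (n + k : ℕ) + 1 : ℝ) / (2 * n + 1)) ^ d) atTop (𝓝 1) := by
  have h1 : Tendsto (fun n : ℕ => (2 * k : ℝ) / (2 * n + 1)) atTop (𝓝 0) := by
    refine Tendsto.div_atTop tendsto_const_nhds ?_
    exact tendsto_atTop_add_const_right _ _
      (tendsto_natCast_atTop_atTop.const_mul_atTop two_pos)
  have h2 := (h1.const_add 1).pow d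
  rw [add_zero, one_pow] at h2
  refine h2.congr fun n => ?_
  congr 1
  have : (2 * n + 1 : ℝ) ≠ 0 := by positivity
  field_simp
  push_cast
  ring

theorem isVanHove_cube (d : ℕ) : IsVanHove (cube d) := by
  refine ⟨cube_nonempty d, fun x => ?_⟩
  obtain ⟨k, hk⟩ := exists_subset_cube {x}
  have hx := mem_cube.1 (Finset.singleton_subset_iff.1 hk)
  have hlim := (tendsto_cube_ratio d k).sub_const 1
  rw [sub_self] at hlim
  refine squeeze_zero (fun n => by positivity) (fun n => ?_) hlim
  have hsub : translate (cube d n) x \ cube d n ⊆ cube d (n + k) \ cube d n := by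
    refine Finset.sdiff_subset_sdiff (fun y hy => ?_) subset_rfl
    obtain ⟨z, hz, rfl⟩ := mem_translate.1 hy
    refine mem_cube.2 fun i => ?_
    have h1 := mem_cube.1 hz i
    have h2 := hx i
    rw [Pi.add_apply]
    push_cast
    omega
  have hcard : (0 : ℝ) < (2 * n + 1) ^ d := by positivity
  have hle : ((translate (cube d n) x \ cube d n).card : ℝ) ≤
      (2 * (n + k : ℕ) + 1) ^ d - (2 * n + 1) ^ d := by
    have h := Finset.card_le_card hsub
    have h' := Finset.card_sdiff_add_card_eq_card (cube_mono (d := d) (Nat.le_add_right n k))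
    rw [card_cube, card_cube] at h'
    rw [le_sub_iff_add_le]
    exact_mod_cast (Nat.add_le_add_right h _).trans h'.le
  rw [card_cube, div_pow, div_sub_one (by positivity)]
  push_cast at hle ⊢
  gcongr

end Cube

/-! ### Packing disjoint cubes -/

section Spacing

variable [MeasurableSpace E] [DiscreteMeasurableSpace E] [Finite E]

/-- The union of the translates of the cube of radius `k` by the elements of `T`. -/
noncomputable def cubesAt (k : ℕ) (T : Finset (Site d)) : Finset (Site d) :=
  T.biUnion fun x => translate (cube d k) x

lemma mem_cubesAt {k : ℕ} {T : Finset (Site d)} {y : Site d} :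
    y ∈ cubesAt k T ↔ ∃ x ∈ T, y ∈ translate (cube d k) x := Finset.mem_biUnion

lemma cubesAt_mono (k : ℕ) {S T : Finset (Site d)} (h : S ⊆ T) : cubesAt k S ⊆ cubesAt k T :=
  Finset.biUnion_subset_biUnion_of_subset_left _ h

/-- Centres in the cube of radius `m` of the lattice of mesh `2 k + 1`. -/
noncomputable def spaced (d k m : ℕ) : Finset (Site d) :=
  (cube d m).image fun u => (2 * k + 1 : ℤ) • u

lemma card_spaced (d k m : ℕ) : (spaced d k m).card = (2 * m + 1) ^ d := by
  rw [spaced, Finset.card_image_of_injective, card_cube]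
  intro u v h
  exact smul_right_injective _ (by omega : (2 * k + 1 : ℤ) ≠ 0) h

/-- The outermost centres have coordinates ±(2k+1)m and the blocks reach k further. The block count
times the block size is exactly the size of the big cube, since 2((2k+1)m + k) + 1 = (2k+1)(2m+1).
-/
lemma cubesAt_spaced_subset (d k m : ℕ) :
    cubesAt k (spaced d k m) ⊆ cube d ((2 * k + 1) * m + k) := by
  intro y hy
  obtain ⟨x, hx, hy⟩ := mem_cubesAt.1 hy
  obtain ⟨u, hu, rfl⟩ := Finset.mem_image.1 hx
  obtain ⟨z, hz, rfl⟩ := mem_translate.1 hy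
  refine mem_cube.2 fun i => ?_
  have h1 := mem_cube.1 hz i
  have h2 := mem_cube.1 hu i
  simp only [Pi.add_apply, Pi.smul_apply, smul_eq_mul]
  push_cast
  constructor <;> nlinarith

/-- In some coordinate the centres differ by at least 2k+1, while two offsets within a block differ
by at most 2k. -/
lemma disjoint_translate_cube_of_mem_spaced {k m : ℕ} {x x' : Site d} (hx : x ∈ spaced d k m)
    (hx' : x' ∈ spaced d k m) (hne : x ≠ x') :
    Disjoint (translate (cube d k) x) (translate (cube d k) x') := by
  rw [Finset.disjoint_left]
  intro y hy hy'
  obtain ⟨u, -, rfl⟩ := Finset.mem_image.1 hx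
  obtain ⟨u', -, rfl⟩ := Finset.mem_image.1 hx'
  obtain ⟨z, hz, rfl⟩ := mem_translate.1 hy
  obtain ⟨z', hz', h⟩ := mem_translate.1 hy'
  refine hne ?_
  congr 1
  ext i
  have h1 := mem_cube.1 hz i
  have h2 := mem_cube.1 hz' i
  have h3 := congrFun h i
  simp only [Pi.add_apply, Pi.smul_apply, smul_eq_mul] at h3
  have h4 : (2 * k + 1 : ℤ) * (u i - u' i) = z' i - z i := by linarith
  by_contra hcon
  rcases lt_or_gt_of_ne hcon with hlt | hlt
  · have : u i - u' i ≤ -1 := by omega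
    nlinarith
  · have : 1 ≤ u i - u' i := by omega
    nlinarith

/-- If the relative entropy density vanishes, there are arbitrarily large volumes `Λ` in which
erasing `Δ` hardly changes the relative entropy. -/
lemma exists_relEnt_sub_relEnt_sdiff_le {μ ν : Measure (Config d E)} [IsProbabilityMeasure μ]
    [IsProbabilityMeasure ν] (hμ : ∀ x, μ.map (shift x) = μ) (hν : ∀ x, ν.map (shift x) = ν)
    (hac : ∀ Λ, AbsContOn Λ μ ν)
    (h0 : Tendsto (fun n => relEnt (cube d n) μ ν / ((cube d n).card : ℝ)) atTop (𝓝 0))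
    {Δ : Finset (Site d)} {k : ℕ} (hΔ : Δ ⊆ cube d k) {δ : ℝ} (hδ : 0 < δ) :
    ∃ Λ, cube d k ⊆ Λ ∧ relEnt Λ μ ν - relEnt (Λ \ Δ) μ ν ≤ δ := by
  have hK : (0 : ℝ) < (2 * k + 1) ^ d := by positivity
  obtain ⟨m, hm⟩ : ∃ m : ℕ, relEnt (cube d ((2 * k + 1) * m + k)) μ ν /
      ((cube d ((2 * k + 1) * m + k)).card : ℝ) < δ / (2 * k + 1) ^ d := by
    have ht : Tendsto (fun m : ℕ => (2 * k + 1) * m + k) atTop atTop :=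
      tendsto_atTop_mono (fun m => by
        change m ≤ _
        nlinarith [Nat.zero_le (k * m)]) tendsto_id
    exact ((h0.comp ht).eventually_lt_const (div_pos hδ hK)).exists
  have hF : relEnt (cubesAt k (spaced d k m)) μ ν ≤ (2 * m + 1) ^ d * δ := by
    refine (relEnt_mono (cubesAt_spaced_subset d k m) (hac _) (hac _)).trans ?_
    have hc : ((cube d ((2 * k + 1) * m + k)).card : ℝ) = (2 * k + 1) ^ d * (2 * m + 1) ^ d := by
      rw [card_cube, ← mul_pow]
      push_cast
      congr 1
      ring
    rw [hc, div_lt_div_iff₀ (by positivity) hK] at hm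
    have h' : relEnt (cube d ((2 * k + 1) * m + k)) μ ν * (2 * k + 1) ^ d <
        ((2 * m + 1) ^ d * δ) * (2 * k + 1) ^ d := by linarith
    exact (lt_of_mul_lt_mul_right h' hK.le).le
  have hsum := sum_insert_sub_before (fun T => relEnt (cubesAt k T) μ ν) (spaced d k m)
  have he : relEnt (cubesAt k ∅) μ ν = 0 := by
    simp [cubesAt, relEnt, prob_empty]
  -- The increments from adding the blocks one by one sum to at most δ times the number of blocks,
  -- so one of them is at most δ.
  obtain ⟨x, hx, hxδ⟩ : ∃ x ∈ spaced d k m,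
      relEnt (cubesAt k (insert x (before (spaced d k m) x))) μ ν -
        relEnt (cubesAt k (before (spaced d k m) x)) μ ν ≤ δ := by
    refine Finset.exists_le_of_sum_le ?_ ?_
    · exact (cube_nonempty d m).image _
    · rw [hsum, he, sub_zero, Finset.sum_const, card_spaced, nsmul_eq_mul]
      exact_mod_cast hF
  set Λ' := cubesAt k (insert x (before (spaced d k m) x)) with hΛ'
  have hcube : translate (cube d k) x ⊆ Λ' := fun y hy =>
    mem_cubesAt.2 ⟨x, Finset.mem_insert_self _ _, hy⟩
  have hsub : cubesAt k (before (spaced d k m) x) ⊆ Λ' \ translate Δ x := by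
    intro y hy
    refine Finset.mem_sdiff.2 ⟨cubesAt_mono k (Finset.subset_insert _ _) hy, fun hyΔ => ?_⟩
    obtain ⟨x', hx', hy'⟩ := mem_cubesAt.1 hy
    have hne : x ≠ x' := by
      rintro rfl
      exact notMem_before _ _ hx'
    exact Finset.disjoint_left.1
      (disjoint_translate_cube_of_mem_spaced hx (mem_before.1 hx').1 hne)
      (translate_subset_translate hΔ x hyΔ) hy'
  -- Removing only Δ + x, rather than the whole new block, loses even less relative entropy.
  have hmono := relEnt_mono hsub (hac _) (hac _)
  refine ⟨translate Λ' (-x), ?_, ?_⟩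
  · have := translate_subset_translate hcube (-x)
    rwa [translate_translate, add_neg_cancel, translate_zero] at this
  · have h1 : translate Λ' (-x) \ Δ = translate (Λ' \ translate Δ x) (-x) := by
      rw [translate_sdiff, translate_translate, add_neg_cancel, translate_zero]
    rw [h1, relEnt_translate (hμ _) (hν _), relEnt_translate (hμ _) (hν _)]
    linarith

end Spacing

/-! ### The entropy formula and the variational principle -/

namespace Specification

variable [MeasurableSpace E] [DiscreteMeasurableSpace E] [TopologicalSpace E] [DiscreteTopology E]
  [Finite E] {γ : Specification d E}

/-- The limit of the relative entropy per site, along van Hove sequences. -/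
theorem tendsto_relEnt_div_card (hn : γ.IsNonnull)
    (hi : γ.IsTranslationInvariant) (hq : γ.IsQuasilocal)
    {ν : Measure (Config d E)} [IsProbabilityMeasure ν] (hν : ∀ Λ, γ.update Λ ν = ν)
    (hν' : ∀ x, ν.map (shift x) = ν)
    {μ : Measure (Config d E)} [IsProbabilityMeasure μ] (hμ : ∀ x, μ.map (shift x) = μ) (e : E)
    {Λ : ℕ → Finset (Site d)} (hΛ : IsVanHove Λ) :
    Tendsto (fun n => relEnt (Λ n) μ ν / ((Λ n).card : ℝ)) atTop
      (𝓝 ((entropyDensity ν + ∫ ω, γ.flipEnergy (fun _ => e) ω ∂ν) -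
        (entropyDensity μ + ∫ ω, γ.flipEnergy (fun _ => e) ω ∂μ))) := by
  have h1 := tendsto_entropy_div_card hμ hΛ
  have h2 := tendsto_entropy_div_card hν' hΛ
  have h3 := tendsto_integral_log_prob_sub_div_card hn hi hq hν hμ e hΛ
  have h4 := tendsto_integral_log_prob_sub_div_card hn hi hq hν hν' e hΛ
  -- In the ν-terms the entropy cancels the integral of log ν_Λ, leaving −log ν(e_Λ), which cancels
  -- the reference term of the μ-energy.
  refine ((h2.add h4).sub (h1.add h3)).congr fun n => ?_
  rw [relEnt_eq, entropy, entropy]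
  ring

lemma absContOn_update (hn : γ.IsNonnull) {Δ Λ : Finset (Site d)} (hΔ : Δ ⊆ Λ)
    (μ : Measure (Config d E)) [IsProbabilityMeasure μ] : AbsContOn Λ μ (γ.update Δ μ) := by
  intro σ h
  by_contra hne
  have hpos : 0 < prob μ (Λ \ Δ) σ :=
    ((prob_nonneg μ Λ σ).lt_of_ne' hne).trans_le (prob_anti μ Finset.sdiff_subset σ)
  obtain ⟨M, hM⟩ := hn.exists_abs_log_selfProb_le Δ
  exact (hn.prob_update_pos_and_abs_log_le hΔ μ hpos (ε := M + M)
    fun ζ _ => (abs_sub _ _).trans (add_le_add (hM _) (hM _))).1.ne' h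

/-- Under both ν = νγ_Δ and μγ_Δ, the log-probability on Λ is within ε of that on Λ ∖ Δ, under ν and
μ respectively, plus log γ_Δ(σ_Δ|σ). The kernel term cancels and the two errors give 2ε. -/
lemma relEnt_update_le (hn : γ.IsNonnull) {ν : Measure (Config d E)} [IsProbabilityMeasure ν]
    (hν : ∀ Λ, γ.update Λ ν = ν) (μ : Measure (Config d E)) [IsProbabilityMeasure μ]
    {Δ Λ : Finset (Site d)} (hΔ : Δ ⊆ Λ) {ε : ℝ}
    (hε : ∀ σ, ∀ ζ ∈ cylinderAt Λ σ,
      |Real.log (γ.selfProb Δ ζ) - Real.log (γ.selfProb Δ σ)| ≤ ε) :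
    relEnt Λ μ (γ.update Δ μ) ≤ relEnt Λ μ ν - relEnt (Λ \ Δ) μ ν + 2 * ε := by
  have hI := fun (ρ : Measure (Config d E)) (Λ : Finset (Site d)) => integrable_log_prob μ ρ Λ
  have hR := fun (ρ : Measure (Config d E)) (Λ : Finset (Site d)) => (hI μ Λ).sub (hI ρ Λ)
  have hrhs : relEnt Λ μ ν - relEnt (Λ \ Δ) μ ν + 2 * ε =
      ∫ ω, ((Real.log (prob μ Λ ω) - Real.log (prob ν Λ ω)) -
        (Real.log (prob μ (Λ \ Δ) ω) - Real.log (prob ν (Λ \ Δ) ω)) + 2 * ε) ∂μ := by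
    rw [integral_add (by exact (hR ν Λ).sub (hR ν (Λ \ Δ))) (integrable_const _),
      integral_sub (by exact hR ν Λ) (by exact hR ν (Λ \ Δ))]
    simp [relEnt]
  rw [hrhs]
  refine integral_mono_ae (hR _ Λ)
    (((hR ν Λ).sub (hR ν (Λ \ Δ))).add (integrable_const _)) ?_
  filter_upwards [ae_prob_pos μ (Λ \ Δ)] with σ hσ
  have h1 := (hn.prob_update_pos_and_abs_log_le hΔ μ hσ (hε σ)).2
  have h2 := (hn.prob_update_pos_and_abs_log_le hΔ ν (hn.prob_pos hν _ σ) (hε σ)).2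
  rw [hν] at h2
  have h1' := (abs_le.1 h1).1
  have h2' := (abs_le.1 h2).2
  linarith

theorem update_eq_of_tendsto_relEnt_zero (hn : γ.IsNonnull) (hq : γ.IsQuasilocal)
    {ν : Measure (Config d E)} [IsProbabilityMeasure ν] (hν : ∀ Λ, γ.update Λ ν = ν)
    (hν' : ∀ x, ν.map (shift x) = ν)
    {μ : Measure (Config d E)} [IsProbabilityMeasure μ] (hμ : ∀ x, μ.map (shift x) = μ)
    (h0 : Tendsto (fun n => relEnt (cube d n) μ ν / ((cube d n).card : ℝ)) atTop (𝓝 0))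
    (Δ : Finset (Site d)) : γ.update Δ μ = μ := by
  have hup := γ.isProbabilityMeasure_update Δ μ
  have hac : ∀ Λ, AbsContOn Λ μ ν := fun Λ ω h => absurd h (hn.prob_pos hν Λ ω).ne'
  have key : ∀ Λ₀ : Finset (Site d), μ.map Λ₀.restrict = (γ.update Δ μ).map Λ₀.restrict := by
    intro Λ₀
    have hm1 := Measure.isProbabilityMeasure_map (μ := μ)
      (Finset.measurable_restrict Λ₀).aemeasurable
    have hm2 := Measure.isProbabilityMeasure_map (μ := γ.update Δ μ)
      (Finset.measurable_restrict Λ₀).aemeasurable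
    rw [← InformationTheory.klDiv_eq_zero_iff]
    refine le_antisymm (ENNReal.le_of_forall_pos_le_add fun ε hε _ => ?_) zero_le
    rw [zero_add]
    have hε' : (0 : ℝ) < ε := hε
    -- The final bound is ε/2 + 2 · (ε/4) = ε.
    obtain ⟨C, hC⟩ := exists_finset_forall_abs_sub_le (hq.continuous_log_selfProb hn Δ)
      (show (0 : ℝ) < ε / 4 by positivity)
    obtain ⟨k, hk⟩ := exists_subset_cube (Λ₀ ∪ Δ ∪ C)
    obtain ⟨hk, hkC⟩ := Finset.union_subset_iff.1 hk
    obtain ⟨hk0, hkΔ⟩ := Finset.union_subset_iff.1 hk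
    obtain ⟨Λ, hkΛ, hΛ⟩ := exists_relEnt_sub_relEnt_sdiff_le hμ hν' hac h0 hkΔ
      (show (0 : ℝ) < ε / 2 by positivity)
    have hΔΛ := hkΔ.trans hkΛ
    refine (klDiv_map_restrict_mono (hk0.trans hkΛ) μ (γ.update Δ μ)).trans ?_
    rw [klDiv_map_restrict (absContOn_update hn hΔΛ μ), ← ENNReal.ofReal_coe_nnreal]
    refine ENNReal.ofReal_le_ofReal ?_
    have := relEnt_update_le hn hν μ hΔΛ (ε := ε / 4) fun σ ζ hζ =>
      hC σ ζ (cylinderAt_anti (hkC.trans hkΛ) σ hζ)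
    linarith
  -- Equal finite-dimensional marginals determine the measure.
  exact IsProjectiveLimit.unique (P := fun Λ : Finset (Site d) => μ.map Λ.restrict)
    (fun Λ => (key Λ).symm) fun Λ => rfl

end Specification

end LatticeGibbs

open LatticeGibbs LatticeGibbs.Specification in
theorem theorem4p1 {d : ℕ} {E : Type*} [Finite E] [TopologicalSpace E] [DiscreteTopology E]
    [MeasurableSpace E] [DiscreteMeasurableSpace E]
    (γ : LatticeGibbs.Specification d E)
    (hnonnull : γ.IsNonnull) (hinv : γ.IsTranslationInvariant) (hql : γ.IsQuasilocal)
    (ν : ProbabilityMeasure (LatticeGibbs.Config d E)) (hν : ν ∈ γ.gibbsInv) :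
    ∀ μ ∈ LatticeGibbs.invMeasures d E, ∃ h : ℝ≥0,
      LatticeGibbs.IsRelEntropyDensityAlong (LatticeGibbs.cube d) μ ν h ∧
      (∀ Λ : ℕ → Finset (LatticeGibbs.Site d), LatticeGibbs.IsVanHove Λ →
        LatticeGibbs.IsRelEntropyDensityAlong Λ μ ν h) ∧
      (μ ∈ γ.gibbsInv ↔ h = 0) := by
  intro μ hμ
  obtain ⟨e⟩ : Nonempty E :=
    (nonempty_of_isProbabilityMeasure (ν : Measure (Config d E))).map fun ω => ω 0
  have hνg := γ.mem_gibbs_iff.1 hν.1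
  have hac : ∀ Λ, AbsContOn Λ (μ : Measure (Config d E)) (ν : Measure (Config d E)) :=
    fun Λ ω h => absurd h (hnonnull.prob_pos hνg Λ ω).ne'
  set P : Measure (Config d E) → ℝ := fun ρ =>
    entropyDensity ρ + ∫ ω, γ.flipEnergy (fun _ => e) ω ∂ρ with hP
  have hlim : ∀ Λ, IsVanHove Λ → Tendsto (fun n => relEnt (Λ n) (μ : Measure (Config d E))
      (ν : Measure (Config d E)) / ((Λ n).card : ℝ)) atTop (𝓝 (P ν - P μ)) := fun Λ hΛ =>
    tendsto_relEnt_div_card hnonnull hinv hql hνg hν.2 hμ e hΛ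
  have hnonneg : 0 ≤ P ν - P μ := ge_of_tendsto' (hlim _ (isVanHove_cube d)) fun n =>
    div_nonneg (relEnt_nonneg (hac _)) (Nat.cast_nonneg _)
  have hdens : ∀ Λ, IsVanHove Λ → IsRelEntropyDensityAlong Λ μ ν (P ν - P μ).toNNReal := by
    intro Λ hΛ
    refine (ENNReal.tendsto_ofReal (hlim Λ hΛ)).congr fun n => ?_
    rw [ENNReal.ofReal_div_of_pos (Nat.cast_pos.2 (Finset.card_pos.2 (hΛ.1 n))),
      ENNReal.ofReal_natCast, finiteVolumeRelEntropy, klDiv_map_restrict (hac _)]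
  refine ⟨(P ν - P μ).toNNReal, hdens _ (isVanHove_cube d), hdens, ?_⟩
  rw [Real.toNNReal_eq_zero]
  constructor
  · intro hμg
    have hμg' := γ.mem_gibbs_iff.1 hμg.1
    -- With μ as the Gibbs reference measure, the same γ and e yield the same P, so the density of ν
    -- relative to μ is P μ − P ν.
    have h := ge_of_tendsto'
      (tendsto_relEnt_div_card hnonnull hinv hql hμg' hμg.2 hν.2 e (isVanHove_cube d)) fun n =>
      div_nonneg (relEnt_nonneg fun ω h => absurd h (hnonnull.prob_pos hμg' _ ω).ne')
        (Nat.cast_nonneg _)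
    change 0 ≤ P μ - P ν at h
    linarith
  · intro h
    have h0 := hlim _ (isVanHove_cube d)
    rw [le_antisymm h hnonneg] at h0
    exact ⟨γ.mem_gibbs_iff.2
      (update_eq_of_tendsto_relEnt_zero hnonnull hql hνg hν.2 hμ h0), hμ⟩
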